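/- For $N\ge 1$ let $\mathscr D_N$ be the set of dimer configurations on the complete graph with vertex set $\{1,\dots,N\}$, that is, the sets $D$ of pairwise non-incident edges. Let $S_N(D)$ be the number of vertices covered by no edge of $D$ (monomers) and $m_N(D)=S_N(D)/N$ the monomer density. For $h\in\mathbb R$ and $J>0$ let $-H_N(D)=N\big((h-J)\,m_N(D)+J\,m_N(D)^2\big)$, and let $\mu_N$ be the Gibbs probability measure on $\mathscr D_N$, $$\mu_N(D)=\frac1{Z_N}\,N^{-|D|}e^{-H_N(D)},\qquad Z_N=\sum_{D\in\mathscr D_N}N^{-|D|}e^{-H_N(D)} .$$ Define, for $x,m\in\mathbb R$, $$g(x)=\frac{e^x}{2}\big(\sqrt{e^{2x}+4}-e^x\big),\quad p^{(0)}(x)=-\frac{1-g(x)}2-\frac12\log(1-g(x)),\quad \widetilde p(m)=-Jm^2+p^{(0)}\big((2m-1)J+h\big).$$ Let $\gamma$ (the coexistence curve) be the set of all $(h,J)\in\mathbb R\times(0,\infty)$ for which $\widetilde p$ has more than one global maximum point on $\mathbb R$. **Theorem.** Let $(h,J)\in\mathbb R\times(0,\infty)$, and let $\overset{\mathcal D}{\to}$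 denote convergence in distribution with respect to $\mu_N$ as $N\to\infty$. i) If $(h,J)\notin\gamma$, then $\widetilde p$ has exactly one global maximum point $m^*$, and $m_N\overset{\mathcal D}{\to}\delta_{m^*}$. ii) If $(h,J)\in\gamma$, then $\widetilde p$ has exactly two global maximum points $m_1<m_2$, they lie in $(0,1)$, the numbers $\lambda_l=\frac{\partial^2}{\partial m^2}\widetilde p(m_l)$, $l=1,2$, are negative, and $$m_N\overset{\mathcal D}{\to}\rho_1\,\delta_{m_1}+\rho_2\,\delta_{m_2},\qquad \rho_l=\frac{b_l}{b_1+b_2},\qquad b_l=\big(-\lambda_l(2-m_l)\big)^{-1/2}.$$ -/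

import Mathlib

open Filter MeasureTheory Set

noncomputable section

/-- A dimer configuration on the simple graph `G`: a finite set of edges of `G` such that for each
vertex `v` there is at most one vertex `u` with `uv` in the set. -/
@[ext]
structure DimerConfig {V : Type*} (G : SimpleGraph V) where
  /-- the set of dimers -/
  dimers : Finset (Sym2 V)
  subset_edgeSet : ∀ e ∈ dimers, e ∈ G.edgeSet
  hardCore : ∀ v u w : V, s(u, v) ∈ dimers → s(w, v) ∈ dimers → u = w

namespace DimerConfig

variable {V : Type*} {G : SimpleGraph V}

instance : Inhabited (DimerConfig G) :=
  ⟨⟨∅, by simp, by simp⟩⟩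

lemma dimers_injective : Function.Injective (dimers : DimerConfig G → Finset (Sym2 V)) :=
  fun _ _ h => DimerConfig.ext h

instance [Fintype V] : Fintype (DimerConfig G) := by
  classical exact Fintype.ofInjective dimers dimers_injective

instance : MeasurableSpace (DimerConfig G) := ⊤

/-- The set of monomers, i.e. of the vertices that belong to no dimer. -/
def monomers (D : DimerConfig G) : Set V :=
  {v | ∀ u : V, s(u, v) ∉ D.dimers}

end DimerConfig

/-- The dimer configurations on the complete graph with `N` vertices. -/
abbrev CompleteDimerConfig (N : ℕ) : Type :=
  DimerConfig (⊤ : SimpleGraph (Fin N))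

/-- The number of monomers `S_N(D)`. -/
def monomerCount {N : ℕ} (D : CompleteDimerConfig N) : ℕ :=
  D.monomers.ncard

/-- The empirical monomer density `m_N(D) = S_N(D) / N`. -/
def monomerDensity {N : ℕ} (D : CompleteDimerConfig N) : ℝ :=
  (monomerCount D : ℝ) / N

/-- The Hamiltonian, `-H_N(D) = N ((h - J) m_N(D) + J m_N(D)^2)`. -/
def imdHamiltonian (h J : ℝ) {N : ℕ} (D : CompleteDimerConfig N) : ℝ :=
  -(N * ((h - J) * monomerDensity D + J * monomerDensity D ^ 2))

/-- The Boltzmann weight `N^{-|D|} exp(-H_N(D))`. -/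
def imdWeight (h J : ℝ) {N : ℕ} (D : CompleteDimerConfig N) : ℝ :=
  (N : ℝ) ^ (-(D.dimers.card : ℤ)) * Real.exp (-imdHamiltonian h J D)

/-- The partition function `Z_N`. -/
def imdPartition (h J : ℝ) (N : ℕ) : ℝ :=
  ∑ D : CompleteDimerConfig N, imdWeight h J D

/-- The Gibbs measure `μ_N`, giving mass `Z_N⁻¹ N^{-|D|} exp(-H_N(D))` to each configuration. -/
def imdGibbs (h J : ℝ) (N : ℕ) : Measure (CompleteDimerConfig N) :=
  ∑ D : CompleteDimerConfig N,
    ENNReal.ofReal (imdWeight h J D / imdPartition h J N) • Measure.dirac D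

lemma imdWeight_pos (h J : ℝ) {N : ℕ} (D : CompleteDimerConfig N) : 0 < imdWeight h J D := by
  refine mul_pos ?_ (Real.exp_pos _)
  rcases Nat.eq_zero_or_pos N with rfl | hN
  · have : D.dimers = ∅ := by
      refine Finset.eq_empty_of_forall_notMem fun e _ => ?_
      induction e with | _ x y => exact x.elim0
    simp [this]
  · have : (0 : ℝ) < N := by exact_mod_cast hN
    positivity

lemma imdPartition_pos (h J : ℝ) (N : ℕ) : 0 < imdPartition h J N :=
  Finset.sum_pos (fun D _ => imdWeight_pos h J D) Finset.univ_nonempty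

instance imdGibbs_isProbabilityMeasure (h J : ℝ) (N : ℕ) :
    IsProbabilityMeasure (imdGibbs h J N) := by
  refine ⟨?_⟩
  have h0 : ∀ D ∈ (Finset.univ : Finset (CompleteDimerConfig N)),
      0 ≤ imdWeight h J D / imdPartition h J N :=
    fun D _ => (div_pos (imdWeight_pos h J D) (imdPartition_pos h J N)).le
  simp only [imdGibbs, Measure.coe_finsetSum, Finset.sum_apply, Measure.smul_apply,
    measure_univ, smul_eq_mul, mul_one]
  rw [← ENNReal.ofReal_sum_of_nonneg h0, ← Finset.sum_div]
  change ENNReal.ofReal (imdPartition h J N / imdPartition h J N) = 1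
  rw [div_self (imdPartition_pos h J N).ne', ENNReal.ofReal_one]

/-- `g(x) = (e^x / 2) (√(e^{2x} + 4) - e^x)`. -/
def gFun (x : ℝ) : ℝ :=
  Real.exp x / 2 * (Real.sqrt (Real.exp (2 * x) + 4) - Real.exp x)

/-- `p⁽⁰⁾(x) = -(1 - g(x)) / 2 - (1 / 2) log (1 - g(x))`. -/
def pZero (x : ℝ) : ℝ :=
  -(1 - gFun x) / 2 - 1 / 2 * Real.log (1 - gFun x)

/-- The variational pressure `p̃(m) = -J m^2 + p⁽⁰⁾((2 m - 1) J + h)`. -/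
def pTilde (h J m : ℝ) : ℝ :=
  -J * m ^ 2 + pZero ((2 * m - 1) * J + h)

/-- The set of global maximum points of the variational pressure on the real line. -/
def globalMaxPoints (h J : ℝ) : Set ℝ :=
  {m | ∀ x : ℝ, pTilde h J x ≤ pTilde h J m}

/-- The coexistence curve in the half-plane `J > 0`: the pairs `(h, J)` for which the variational
pressure has more than one global maximum point. -/
def coexistenceCurve : Set (ℝ × ℝ) :=
  {q | 0 < q.2 ∧ (globalMaxPoints q.1 q.2).Nontrivial}

/-- `λ(m)`, the second derivative of the variational pressure at `m`. -/
def curvature (h J m : ℝ) : ℝ :=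
  iteratedDeriv 2 (pTilde h J) m

/-- `b(m) = (-λ(m) (2 - m))^{-1/2}`. -/
def phaseWeight (h J m : ℝ) : ℝ :=
  (-curvature h J m * (2 - m)) ^ (-(1 / 2) : ℝ)

end

/-! The matching polynomial of the complete graph satisfies the Hermite recursion, so the
monomer-dimer partition function with monomer field `x` is the Gaussian moment `E (e^x + ξ/√N)^N`
(`sum_dimerConfig_eq_gaussMoment`). Translating the Gaussian variable to the saddle point, given by
the positive root `s` of `s² + e^x s = 1`, turns it into `exp (N p⁽⁰⁾(x))` times a factor that tends
to `(1 + s²)^(-1/2) = (2 - g(x))^(-1/2)` (`monomerDimerPartition_eq`, `tendsto_saddleFactor`).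

The quadratic interaction is linearized by adding to `m_N` an independent centred Gaussian of
variance `1/(2NJ)`. The smoothed law has density proportional to `exp (N p̃(y))` times the same
factor at `x = (2y - 1)J + h` (`exp_pTilde_mul_saddleFactor`), and the smoothing moves bounded
Lipschitz averages by `O(N^(-1/2))` (`tendsto_smoothed_sub_gibbs`). Laplace's method then applies.
Each nondegenerate maximum `m` gets mass proportional to `(-λ)^(-1/2) (2 - m)^(-1/2)`, since `g = m`
there (`prefactor_eq_phaseWeight`). At a unique maximum no nondegeneracy is needed: the total mass
is at least of order `N^(-1/2)`, while the mass away from the maximum is exponentially small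
(`LaplaceData.tendsto_ratio_of_unique`).

It remains to count the maxima. The defect `g⁻¹(m) - ((2m - 1)J + h)` has the sign opposite to that
of `p̃'`, and its derivative has the sign of a strictly convex quadratic `Q`. Between two maxima `Q`
is negative somewhere, while at each of them `Q > 0`; by convexity there cannot be three maxima
(`not_three_globalMaxPoints`), and `Q > 0` makes the curvature negative
(`curvature_neg_of_defectQuadratic_pos`). -/

open scoped Topology

/-! ### The matching polynomial of the complete graph. -/

/-- The matchings of the complete graph on the finite set of vertices `A`. -/
def matchingsIn {V : Type*} [Fintype V] (A : Finset V) : Set (Finset (Sym2 V)) :=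
  {M | (∀ u v, s(u, v) ∈ M → u ≠ v ∧ u ∈ A ∧ v ∈ A) ∧
    ∀ v u w, s(u, v) ∈ M → s(w, v) ∈ M → u = w}

lemma mem_matchingsIn {V : Type*} [Fintype V] {A : Finset V} {M : Finset (Sym2 V)} :
    M ∈ matchingsIn A ↔ (∀ u v, s(u, v) ∈ M → u ≠ v ∧ u ∈ A ∧ v ∈ A) ∧
      ∀ v u w, s(u, v) ∈ M → s(w, v) ∈ M → u = w :=
  Iff.rfl

open Classical in
/-- The contribution `t^{|M|} a^{#monomers}` of a matching `M` to the matching polynomial of the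
complete graph on `A`. -/
noncomputable def matchingWeight {V : Type*} [Fintype V] (t a : ℝ) (A : Finset V) (M : Finset (Sym2 V)) : ℝ :=
  t ^ M.card * a ^ (A.filter fun v => ∀ u, s(u, v) ∉ M).card

open Classical in
/-- The matching polynomial of the complete graph on `A`. -/
noncomputable def matchingSum {V : Type*} [Fintype V] (t a : ℝ) (A : Finset V) : ℝ :=
  ∑ M ∈ (matchingsIn A).toFinset, matchingWeight t a A M

section Matchings

variable {V : Type*} [Fintype V]

lemma matchingSum_empty (t a : ℝ) : matchingSum t a (∅ : Finset V) = 1 := by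
  classical
  have : (matchingsIn (∅ : Finset V)).toFinset = {∅} := by
    ext M
    rw [Set.mem_toFinset, Finset.mem_singleton, mem_matchingsIn]
    constructor
    · rintro ⟨h, -⟩
      refine Finset.eq_empty_of_forall_notMem fun e => ?_
      induction e with | _ x y => exact fun he => by simpa using (h x y he).2.1
    · rintro rfl
      simp
  simp [matchingSum, this, matchingWeight]

open Classical in
-- A matching either leaves the new vertex `v` single or pairs it with a unique `u`; removing that
-- edge leaves a matching avoiding both ends.
lemma matchingsIn_insert {A : Finset V} {v : V} (hv : v ∉ A) :
    (matchingsIn (insert v A)).toFinset = (matchingsIn A).toFinset ∪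
      A.biUnion fun u => (matchingsIn (A.erase u)).toFinset.image (insert s(u, v)) := by
  ext M
  simp only [Set.mem_toFinset, Finset.mem_union, Finset.mem_biUnion, Finset.mem_image]
  constructor
  · rintro ⟨h1, h2⟩
    by_cases hM : ∃ u, s(u, v) ∈ M
    · obtain ⟨u, hu⟩ := hM
      right
      have huA : u ∈ A := by
        have := h1 u v hu
        rcases Finset.mem_insert.1 this.2.1 with h | h
        · exact absurd h this.1
        · exact h
      refine ⟨u, huA, M.erase s(u, v), ⟨?_, ?_⟩, Finset.insert_erase hu⟩
      · intro x y hxy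
        obtain ⟨hne, hxy⟩ := Finset.mem_erase.1 hxy
        obtain ⟨h3, h4, h5⟩ := h1 x y hxy
        have key : ∀ p q, s(p, q) ∈ M → s(p, q) ≠ s(u, v) → p ∈ insert v A → p ∈ A.erase u := by
          intro p q hpq hpq' hp
          have hpv : p ≠ v := by
            rintro rfl
            have := h2 p u q hu (by rwa [Sym2.eq_swap])
            subst this
            exact hpq' Sym2.eq_swap
          have hpu : p ≠ u := by
            rintro rfl
            have := h2 p v q (by rwa [Sym2.eq_swap]) (by rwa [Sym2.eq_swap])
            subst this
            exact hpq' rfl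
          exact Finset.mem_erase.2 ⟨hpu, (Finset.mem_insert.1 hp).resolve_left hpv⟩
        exact ⟨h3, key x y hxy hne h4,
          key y x (by rwa [Sym2.eq_swap]) (by rwa [Sym2.eq_swap]) h5⟩
      · intro x y z hy hz
        exact h2 x y z (Finset.mem_of_mem_erase hy) (Finset.mem_of_mem_erase hz)
    · push Not at hM
      left
      refine ⟨fun x y hxy => ?_, h2⟩
      obtain ⟨h3, h4, h5⟩ := h1 x y hxy
      refine ⟨h3, (Finset.mem_insert.1 h4).resolve_left ?_,
        (Finset.mem_insert.1 h5).resolve_left ?_⟩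
      · rintro rfl
        exact hM y (by rwa [Sym2.eq_swap])
      · rintro rfl
        exact hM x hxy
  · rintro (⟨h1, h2⟩ | ⟨u, hu, M, ⟨h1, h2⟩, rfl⟩)
    · exact ⟨fun x y hxy => ⟨(h1 x y hxy).1, Finset.mem_insert_of_mem (h1 x y hxy).2.1,
        Finset.mem_insert_of_mem (h1 x y hxy).2.2⟩, h2⟩
    · have huv : u ≠ v := fun h => hv (h ▸ hu)
      refine ⟨fun x y hxy => ?_, fun x y z hy hz => ?_⟩
      · rcases Finset.mem_insert.1 hxy with h | h
        · rcases Sym2.eq_iff.1 h with ⟨rfl, rfl⟩ | ⟨rfl, rfl⟩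
          · exact ⟨huv, by simp [hu], by simp⟩
          · exact ⟨huv.symm, by simp, by simp [hu]⟩
        · obtain ⟨h3, h4, h5⟩ := h1 x y h
          exact ⟨h3, Finset.mem_insert_of_mem (Finset.mem_of_mem_erase h4),
            Finset.mem_insert_of_mem (Finset.mem_of_mem_erase h5)⟩
      · have key : ∀ p q, s(p, q) ∈ M → q ≠ u ∧ q ≠ v := by
          intro p q hpq
          have := (h1 p q hpq).2.2
          exact ⟨Finset.ne_of_mem_erase this, fun h => hv (h ▸ Finset.mem_of_mem_erase this)⟩
        rcases Finset.mem_insert.1 hy with h | h <;> rcases Finset.mem_insert.1 hz with h' | h'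
        · rcases Sym2.eq_iff.1 h with ⟨rfl, rfl⟩ | ⟨rfl, rfl⟩ <;>
          rcases Sym2.eq_iff.1 h' with ⟨h3, h4⟩ | ⟨h3, h4⟩ <;> simp_all
        · rcases Sym2.eq_iff.1 h with ⟨rfl, rfl⟩ | ⟨rfl, rfl⟩
          · exact absurd rfl (key _ _ h').2
          · exact absurd rfl (key _ _ h').1
        · rcases Sym2.eq_iff.1 h' with ⟨rfl, rfl⟩ | ⟨rfl, rfl⟩
          · exact absurd rfl (key _ _ h).2
          · exact absurd rfl (key _ _ h).1
        · exact h2 x y z h h'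

open Classical in
lemma matchingWeight_insert_of_mem_matchingsIn (t a : ℝ) {A : Finset V} {v : V} (hv : v ∉ A)
    {M : Finset (Sym2 V)} (hM : M ∈ matchingsIn A) :
    matchingWeight t a (insert v A) M = a * matchingWeight t a A M := by
  have h : ∀ u, s(u, v) ∉ M := fun u hu => hv (hM.1 u v hu).2.2
  rw [matchingWeight, matchingWeight, Finset.filter_insert, if_pos h,
    Finset.card_insert_of_notMem (by simp [hv]), pow_succ]
  ring

open Classical in
lemma matchingWeight_insert_edge (t a : ℝ) {A : Finset V} {u v : V} (hv : v ∉ A) (hu : u ∈ A)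
    {M : Finset (Sym2 V)} (hM : M ∈ matchingsIn (A.erase u)) :
    matchingWeight t a (insert v A) (insert s(u, v) M) =
      t * matchingWeight t a (A.erase u) M := by
  have huv : u ≠ v := fun h => hv (h ▸ hu)
  have hM' : s(u, v) ∉ M := fun h => by simpa using (hM.1 u v h).2.1
  have : ((insert v A).filter fun x => ∀ y, s(y, x) ∉ insert s(u, v) M) =
      (A.erase u).filter fun x => ∀ y, s(y, x) ∉ M := by
    ext x
    simp only [Finset.mem_filter, Finset.mem_insert, Finset.mem_erase, not_or]
    constructor
    · rintro ⟨h1, h2⟩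
      have hxv : x ≠ v := fun h => (h2 u).1 (by rw [h])
      have hxu : x ≠ u := fun h => (h2 v).1 (by rw [h, Sym2.eq_swap])
      exact ⟨⟨hxu, h1.resolve_left hxv⟩, fun y => (h2 y).2⟩
    · rintro ⟨⟨h1, h2⟩, h3⟩
      refine ⟨Or.inr h2, fun y => ⟨fun h => ?_, h3 y⟩⟩
      rcases Sym2.eq_iff.1 h with ⟨-, rfl⟩ | ⟨-, rfl⟩
      · exact hv h2
      · exact h1 rfl
  rw [matchingWeight, matchingWeight, this, Finset.card_insert_of_notMem hM', pow_succ]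
  ring

open Classical in
lemma matchingSum_insert (t a : ℝ) {A : Finset V} {v : V} (hv : v ∉ A) :
    matchingSum t a (insert v A) =
      a * matchingSum t a A + t * ∑ u ∈ A, matchingSum t a (A.erase u) := by
  have hnot : ∀ u ∈ A, ∀ M ∈ matchingsIn (A.erase u), ∀ x, s(x, v) ∉ M :=
    fun u _ M hM x hx => hv (Finset.mem_of_mem_erase (hM.1 x v hx).2.2)
  rw [matchingSum, matchingsIn_insert hv, Finset.sum_union, Finset.sum_biUnion]
  · congr 1
    · rw [matchingSum, Finset.mul_sum]
      exact Finset.sum_congr rfl fun M hM =>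
        matchingWeight_insert_of_mem_matchingsIn t a hv (by simpa using hM)
    · rw [Finset.mul_sum]
      refine Finset.sum_congr rfl fun u hu => ?_
      rw [Finset.sum_image, matchingSum, Finset.mul_sum]
      · exact Finset.sum_congr rfl fun M hM =>
          matchingWeight_insert_edge t a hv hu (by simpa using hM)
      · intro M hM M' hM' h
        have h1 := hnot u hu M (by simpa using hM) u
        have h2 := hnot u hu M' (by simpa using hM') u
        rw [← Finset.erase_insert h1, ← Finset.erase_insert h2, h]
  · intro u hu w hw huw
    rw [Function.onFun, Finset.disjoint_left]
    simp only [Finset.mem_image, Set.mem_toFinset, not_exists, not_and]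
    rintro _ ⟨M, hM, rfl⟩ M' hM' h
    have h3 : s(w, v) ∈ insert s(u, v) M := h ▸ Finset.mem_insert_self _ _
    rcases Finset.mem_insert.1 h3 with h4 | h4
    · rcases Sym2.eq_iff.1 h4 with ⟨h5, -⟩ | ⟨h5, h6⟩
      · exact huw h5.symm
      · exact huw (h6 ▸ h5.symm)
    · exact hnot u hu M hM w h4
  · rw [Finset.disjoint_left]
    simp only [Finset.mem_biUnion, Finset.mem_image, Set.mem_toFinset, not_exists, not_and]
    rintro M hM u hu M' hM' rfl
    exact hv (hM.1 u v (Finset.mem_insert_self _ _)).2.2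

/-- The matching polynomial of the complete graph is determined by its recursion. -/
lemma matchingSum_eq_of_recursion {t a : ℝ} {P : ℕ → ℝ} (h0 : P 0 = 1) (h1 : P 1 = a)
    (h2 : ∀ n, P (n + 2) = a * P (n + 1) + t * ((n + 1) * P n)) (n : ℕ) :
    ∀ A : Finset V, A.card = n → matchingSum t a A = P n := by
  classical
  induction n using Nat.strong_induction_on with
  | _ n ih =>
    intro A hA
    rcases n with _ | n
    · rw [Finset.card_eq_zero] at hA
      rw [hA, h0, matchingSum_empty]
    · obtain ⟨v, B, hv, rfl, hB⟩ := Finset.card_eq_succ.1 hA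
      rw [matchingSum_insert t a hv, ih n (Nat.lt_succ_self n) B hB]
      -- A single vertex is treated apart because the two-step recursion for `P` only starts at `P
      -- 2`.
      rcases n with _ | n
      · rw [Finset.card_eq_zero] at hB
        simp [hB, h0, h1]
      · have : ∀ u ∈ B, matchingSum t a (B.erase u) = P n := fun u hu =>
          ih n (by omega) _ (by rw [Finset.card_erase_of_mem hu, hB]; rfl)
        rw [Finset.sum_congr rfl this, Finset.sum_const, hB, h2]
        simp

end Matchings

lemma sum_dimerConfig_eq_matchingSum (N : ℕ) (t a : ℝ) :
    ∑ D : CompleteDimerConfig N, t ^ D.dimers.card * a ^ monomerCount D =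
      matchingSum t a (Finset.univ : Finset (Fin N)) := by
  classical
  rw [matchingSum]
  refine Finset.sum_bij (fun D _ => D.dimers) ?_ ?_ ?_ ?_
  · intro D _
    simp only [Set.mem_toFinset, mem_matchingsIn, Finset.mem_univ, and_true]
    exact ⟨fun u v h => by simpa using D.subset_edgeSet _ h, D.hardCore⟩
  · intro D _ D' _ h
    exact DimerConfig.dimers_injective h
  · intro M hM
    simp only [Set.mem_toFinset, mem_matchingsIn, Finset.mem_univ, and_true] at hM
    refine ⟨⟨M, fun e => ?_, hM.2⟩, Finset.mem_univ _, rfl⟩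
    induction e with | _ x y => exact fun h => by simpa using hM.1 x y h
  · intro D _
    rw [matchingWeight, monomerCount, DimerConfig.monomers, Set.ncard_eq_toFinset_card']
    congr 3
    ext v
    simp

/-! ### Gaussian moments and the partition function. -/

lemma integrable_pow_mul_exp_neg_sq_half (n : ℕ) :
    Integrable fun v : ℝ => v ^ n * Real.exp (-(v ^ 2 / 2)) := by
  have := integrable_rpow_mul_exp_neg_mul_sq (b := 1 / 2) (by norm_num) (s := n)
    (by have : (0 : ℝ) ≤ n := n.cast_nonneg
        linarith)
  refine this.congr (Eventually.of_forall fun v => ?_)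
  simp only [Real.rpow_natCast]
  ring_nf

lemma integrable_affine_pow_mul_exp (a b : ℝ) (n : ℕ) :
    Integrable fun v : ℝ => (a + b * v) ^ n * Real.exp (-(v ^ 2 / 2)) := by
  have : (fun v : ℝ => (a + b * v) ^ n * Real.exp (-(v ^ 2 / 2))) = fun v =>
      ∑ k ∈ Finset.range (n + 1),
        (a ^ k * b ^ (n - k) * n.choose k) * (v ^ (n - k) * Real.exp (-(v ^ 2 / 2))) := by
    ext v
    rw [add_pow, Finset.sum_mul]
    refine Finset.sum_congr rfl fun k _ => ?_
    rw [mul_pow]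
    ring
  rw [this]
  exact integrable_finsetSum _ fun k _ => (integrable_pow_mul_exp_neg_sq_half _).const_mul _

lemma integral_exp_neg_sq_half : ∫ v : ℝ, Real.exp (-(v ^ 2 / 2)) = √(2 * Real.pi) := by
  have := integral_gaussian (1 / 2)
  rw [show Real.pi / (1 / 2) = 2 * Real.pi by ring] at this
  rw [← this]
  congr 1
  ext v
  ring_nf

/-- The Gaussian moment `E (a + b ξ)^n`, for a standard Gaussian `ξ`. -/
noncomputable def gaussMoment (a b : ℝ) (n : ℕ) : ℝ :=
  (√(2 * Real.pi))⁻¹ * ∫ v : ℝ, (a + b * v) ^ n * Real.exp (-(v ^ 2 / 2))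

lemma gaussMoment_zero (a b : ℝ) : gaussMoment a b 0 = 1 := by
  have : √(2 * Real.pi) ≠ 0 := by positivity
  rw [gaussMoment]
  simp only [pow_zero, one_mul]
  rw [integral_exp_neg_sq_half, inv_mul_cancel₀ this]

lemma hasDerivAt_exp_neg_sq_half (v : ℝ) :
    HasDerivAt (fun v : ℝ => Real.exp (-(v ^ 2 / 2))) (Real.exp (-(v ^ 2 / 2)) * (-v)) v := by
  have := (((hasDerivAt_id v).pow 2).div_const 2).neg.exp
  convert! this using 1
  simp

lemma gaussMoment_one (a b : ℝ) : gaussMoment a b 1 = a := by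
  have hpi : √(2 * Real.pi) ≠ 0 := by positivity
  have h0 : ∫ v : ℝ, v * Real.exp (-(v ^ 2 / 2)) = 0 := by
    have := integral_eq_zero_of_hasDerivAt_of_integrable (f := fun v : ℝ => Real.exp (-(v ^ 2 / 2)))
      hasDerivAt_exp_neg_sq_half (by simpa [mul_comm] using
        (integrable_pow_mul_exp_neg_sq_half 1).neg)
      (by simpa using integrable_pow_mul_exp_neg_sq_half 0)
    rw [← neg_eq_zero, ← integral_neg, ← this]
    congr 1
    ext v
    ring
  have h1 : Integrable fun v : ℝ => a * Real.exp (-(v ^ 2 / 2)) := by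
    simpa using (integrable_pow_mul_exp_neg_sq_half 0).const_mul a
  have h2 : Integrable fun v : ℝ => b * (v * Real.exp (-(v ^ 2 / 2))) := by
    simpa using (integrable_pow_mul_exp_neg_sq_half 1).const_mul b
  have : ∫ v : ℝ, (a + b * v) ^ 1 * Real.exp (-(v ^ 2 / 2)) = a * √(2 * Real.pi) := by
    simp_rw [pow_one, add_mul, mul_assoc]
    rw [integral_add h1 h2, integral_const_mul, integral_const_mul, h0, integral_exp_neg_sq_half]
    ring
  rw [gaussMoment, this]
  field_simp

/-- Gaussian integration by parts: the total derivative of `b (a + bv)^(n+1) e^(-v²/2)` integrates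
to zero, and the factor `-bv` from the exponential is rewritten as `a - (a + bv)`. This is the
recursion of the matching polynomial with edge activity `b²`. -/
lemma gaussMoment_add_two (a b : ℝ) (n : ℕ) :
    gaussMoment a b (n + 2) =
      a * gaussMoment a b (n + 1) + b ^ 2 * ((n + 1) * gaussMoment a b n) := by
  have hd : ∀ v : ℝ, HasDerivAt
      (fun v : ℝ => b * ((a + b * v) ^ (n + 1) * Real.exp (-(v ^ 2 / 2))))
      (b ^ 2 * (n + 1) * ((a + b * v) ^ n * Real.exp (-(v ^ 2 / 2))) +
        (a * ((a + b * v) ^ (n + 1) * Real.exp (-(v ^ 2 / 2))) -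
          (a + b * v) ^ (n + 2) * Real.exp (-(v ^ 2 / 2)))) v := by
    intro v
    have h1 : HasDerivAt (fun v : ℝ => a + b * v) b v := by
      simpa using ((hasDerivAt_id v).const_mul b).const_add a
    convert! ((h1.pow (n + 1)).mul (hasDerivAt_exp_neg_sq_half v)).const_mul b using 1
    push_cast
    simp only [Pi.pow_apply]
    ring
  have i0 := (integrable_affine_pow_mul_exp a b n).const_mul (b ^ 2 * (n + 1))
  have i1 := (integrable_affine_pow_mul_exp a b (n + 1)).const_mul a
  have i2 := integrable_affine_pow_mul_exp a b (n + 2)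
  have := integral_eq_zero_of_hasDerivAt_of_integrable hd (i0.add (i1.sub i2))
    ((integrable_affine_pow_mul_exp a b (n + 1)).const_mul b)
  rw [integral_add (g := fun v : ℝ => a * ((a + b * v) ^ (n + 1) * Real.exp (-(v ^ 2 / 2))) -
    (a + b * v) ^ (n + 2) * Real.exp (-(v ^ 2 / 2))) i0 (i1.sub i2), integral_sub i1 i2, integral_const_mul, integral_const_mul]
    at this
  simp only [gaussMoment]
  linear_combination (-(√(2 * Real.pi))⁻¹) * this

/-- The monomer-dimer partition function with monomer activity `a` is a Gaussian moment. -/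
lemma sum_dimerConfig_eq_gaussMoment (N : ℕ) (a : ℝ) :
    ∑ D : CompleteDimerConfig N, (N : ℝ) ^ (-(D.dimers.card : ℤ)) * a ^ monomerCount D =
      gaussMoment a (√N)⁻¹ N := by
  rw [← matchingSum_eq_of_recursion (V := Fin N) (t := ((√N)⁻¹) ^ 2) (gaussMoment_zero a _)
    (gaussMoment_one a _) (gaussMoment_add_two a _) N Finset.univ (by simp),
    ← sum_dimerConfig_eq_matchingSum]
  refine Finset.sum_congr rfl fun D _ => ?_
  rw [inv_pow, Real.sq_sqrt N.cast_nonneg, zpow_neg, zpow_natCast, inv_pow]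

/-! ### Saddle point analysis of the Gaussian moment. -/

/-- `ξ(x) = (√(e^{2x} + 4) - e^x) / 2`, the saddle point of the Gaussian representation. -/
noncomputable def saddle (x : ℝ) : ℝ :=
  (√(Real.exp (2 * x) + 4) - Real.exp x) / 2

lemma exp_lt_sqrt_exp_add_four (x : ℝ) : Real.exp x < √(Real.exp (2 * x) + 4) := by
  refine Real.lt_sqrt_of_sq_lt ?_
  rw [← Real.exp_nat_mul]
  push_cast
  linarith

lemma saddle_pos (x : ℝ) : 0 < saddle x := by
  have := exp_lt_sqrt_exp_add_four x
  unfold saddle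
  linarith

/-- This is the critical point equation of `s ↦ log (e^x + s) - s²/2`. It gives both `e^x + s = 1/s`
and `g = e^x s = 1 - s²`, through which all later computations pass. -/
lemma saddle_sq_add (x : ℝ) : saddle x ^ 2 + Real.exp x * saddle x = 1 := by
  have h1 : √(Real.exp (2 * x) + 4) ^ 2 = Real.exp (2 * x) + 4 := Real.sq_sqrt (by positivity)
  have h2 : Real.exp (2 * x) = Real.exp x ^ 2 := by rw [← Real.exp_nat_mul]; norm_cast
  rw [h2] at h1
  unfold saddle
  rw [h2]
  linear_combination h1 / 4

lemma saddle_lt_one (x : ℝ) : saddle x < 1 := by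
  nlinarith [saddle_sq_add x, mul_pos (Real.exp_pos x) (saddle_pos x), saddle_pos x]

lemma gFun_eq_one_sub_saddle_sq (x : ℝ) : gFun x = 1 - saddle x ^ 2 := by
  have : gFun x = Real.exp x * saddle x := by
    unfold gFun saddle
    ring
  linarith [saddle_sq_add x]

lemma pZero_eq_saddle (x : ℝ) : pZero x = -(saddle x ^ 2 / 2) - Real.log (saddle x) := by
  rw [pZero, gFun_eq_one_sub_saddle_sq, sub_sub_cancel, Real.log_pow]
  push_cast
  ring

lemma gFun_pos (x : ℝ) : 0 < gFun x := by
  rw [gFun_eq_one_sub_saddle_sq]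
  nlinarith [saddle_pos x, saddle_lt_one x]

lemma gFun_lt_one (x : ℝ) : gFun x < 1 := by
  rw [gFun_eq_one_sub_saddle_sq]
  nlinarith [saddle_pos x, saddle_lt_one x]

lemma continuous_saddle : Continuous saddle := by
  unfold saddle
  fun_prop

/-- The normalized integral left over after moving the Gaussian representation to its saddle
point. -/
noncomputable def saddleFactor (n : ℕ) (s : ℝ) : ℝ :=
  (√(2 * Real.pi))⁻¹ * ∫ v : ℝ, ((1 + s * ((√n)⁻¹ * v)) * Real.exp (-(s * ((√n)⁻¹ * v)))) ^ n *
    Real.exp (-(v ^ 2 / 2))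

/-- Translate by `√n s`. Since `e^x + s = 1/s`, the power yields `s^(-n) (1 + sv/√n)^n`; the cross
term of the square supplies `e^(-sv/√n)` to the power `n`, and its constant term completes `e^(n
p⁽⁰⁾)`. -/
lemma gaussMoment_eq_saddleFactor (x : ℝ) {n : ℕ} (hn : n ≠ 0) :
    gaussMoment (Real.exp x) (√n)⁻¹ n = Real.exp (n * pZero x) * saddleFactor n (saddle x) := by
  have hs := saddle_pos x
  have hsq := saddle_sq_add x
  set s := saddle x with hs_def
  have hn' : (0 : ℝ) < √n := Real.sqrt_pos.2 (by positivity)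
  rw [gaussMoment, saddleFactor, mul_left_comm]
  congr 1
  rw [← integral_const_mul, ← integral_add_right_eq_self (μ := volume) (fun v : ℝ =>
    (Real.exp x + (√n)⁻¹ * v) ^ n * Real.exp (-(v ^ 2 / 2))) (√n * s)]
  refine integral_congr_ae (Eventually.of_forall fun v => ?_)
  beta_reduce
  have hexp : Real.exp (n * pZero x) = (s⁻¹) ^ n * Real.exp (-(n * s ^ 2 / 2)) := by
    rw [pZero_eq_saddle, ← hs_def, ← Real.exp_log (inv_pos.2 hs), ← Real.exp_nat_mul,
      ← Real.exp_add, Real.log_inv]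
    congr 1
    ring
  have h1 : Real.exp x + (√n)⁻¹ * (v + √n * s) = s⁻¹ * (1 + s * ((√n)⁻¹ * v)) := by
    have : (√n)⁻¹ * √n = 1 := inv_mul_cancel₀ hn'.ne'
    have h2 : Real.exp x + s = s⁻¹ := by
      field_simp
      linarith
    rw [mul_add, ← mul_assoc, this, mul_add, ← mul_assoc, inv_mul_cancel₀ hs.ne', ← h2]
    ring
  have h3 : Real.exp (-((v + √n * s) ^ 2 / 2)) = Real.exp (-(n * s ^ 2 / 2)) *
      Real.exp (-(s * ((√n)⁻¹ * v))) ^ n * Real.exp (-(v ^ 2 / 2)) := by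
    rw [← Real.exp_nat_mul, ← Real.exp_add, ← Real.exp_add]
    congr 1
    have h4 : (n : ℝ) * (√n)⁻¹ = √n := by
      rw [← div_eq_mul_inv, Real.div_sqrt]
    have h5 : √(n : ℝ) ^ 2 = n := Real.sq_sqrt n.cast_nonneg
    linear_combination -(s ^ 2 / 2) * h5 + s * v * h4
  rw [h1, h3, hexp, mul_pow, mul_pow]
  ring

/-- Both bounds are tangent line inequalities for `exp`: `1 + t ≤ e^t`, and `-(1 + t) ≤ e^(-2-t)`,
where `-2 - t ≤ t²/2 + t` because `(t + 2)² ≥ 0`. -/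
lemma abs_one_add_mul_exp_neg_le (t : ℝ) :
    |(1 + t) * Real.exp (-t)| ≤ Real.exp (t ^ 2 / 2) := by
  rw [abs_mul, abs_of_pos (Real.exp_pos _), Real.exp_neg, ← div_eq_mul_inv,
    div_le_iff₀ (Real.exp_pos _), ← Real.exp_add, abs_le]
  constructor
  · have h1 := Real.add_one_le_exp (-2 - t)
    have h2 : Real.exp (-2 - t) ≤ Real.exp (t ^ 2 / 2 + t) :=
      Real.exp_le_exp.2 (by nlinarith [sq_nonneg (t + 2)])
    linarith
  · have h1 := Real.add_one_le_exp t
    have h2 : Real.exp t ≤ Real.exp (t ^ 2 / 2 + t) := Real.exp_le_exp.2 (by nlinarith [sq_nonneg t])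
    linarith

/-- The bound does not depend on `n`, and `q` is kept separate from `s²` so that a single dominating
function serves a whole convergent sequence of values of `s`. -/
lemma abs_saddleFactor_integrand_le {n : ℕ} (hn : n ≠ 0) {s q : ℝ} (hs : s ^ 2 ≤ q) (v : ℝ) :
    |((1 + s * ((√n)⁻¹ * v)) * Real.exp (-(s * ((√n)⁻¹ * v)))) ^ n * Real.exp (-(v ^ 2 / 2))| ≤
      Real.exp (-((1 - q) / 2) * v ^ 2) := by
  rw [abs_mul, abs_pow, abs_of_pos (Real.exp_pos _)]
  calc _ ≤ Real.exp ((s * ((√n)⁻¹ * v)) ^ 2 / 2) ^ n * Real.exp (-(v ^ 2 / 2)) := by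
        gcongr
        exact abs_one_add_mul_exp_neg_le _
    _ = Real.exp (-((1 - s ^ 2) / 2) * v ^ 2) := by
        rw [← Real.exp_nat_mul, ← Real.exp_add]
        congr 1
        have h5 : (n : ℝ) * ((√n)⁻¹) ^ 2 = 1 := by
          rw [inv_pow, Real.sq_sqrt n.cast_nonneg, mul_inv_cancel₀ (by exact_mod_cast hn)]
        linear_combination (s ^ 2 * v ^ 2 / 2) * h5
    _ ≤ _ := by
        refine Real.exp_le_exp.2 ?_
        nlinarith [sq_nonneg v]

lemma saddleFactor_le {n : ℕ} (hn : n ≠ 0) {s : ℝ} (hs : s ^ 2 < 1) :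
    |saddleFactor n s| ≤ (√(1 - s ^ 2))⁻¹ := by
  have hpos : 0 < (1 - s ^ 2) / 2 := by linarith
  rw [saddleFactor, abs_mul, abs_of_pos (by positivity)]
  have h1 : ‖∫ v : ℝ, ((1 + s * ((√n)⁻¹ * v)) * Real.exp (-(s * ((√n)⁻¹ * v)))) ^ n *
      Real.exp (-(v ^ 2 / 2))‖ ≤ ∫ v : ℝ, Real.exp (-((1 - s ^ 2) / 2) * v ^ 2) :=
    norm_integral_le_of_norm_le (integrable_exp_neg_mul_sq hpos)
      (Eventually.of_forall fun v => abs_saddleFactor_integrand_le hn le_rfl v)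
  rw [integral_gaussian, Real.norm_eq_abs] at h1
  calc _ ≤ (√(2 * Real.pi))⁻¹ * √(Real.pi / ((1 - s ^ 2) / 2)) := by gcongr
    _ = _ := by
      rw [← Real.sqrt_inv, ← Real.sqrt_inv, ← Real.sqrt_mul (by positivity)]
      congr 1
      have := Real.pi_pos
      have h2 : 1 - s ^ 2 ≠ 0 := by linarith
      field_simp

/-- Second order expansion at a critical point. -/
lemma isLittleO_of_hasDerivAt_critical {F F' : ℝ → ℝ} {m c : ℝ}
    (hF : ∀ᶠ y in 𝓝 m, HasDerivAt F (F' y) y) (h0 : F' m = 0) (h2 : HasDerivAt F' c m) :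
    (fun y => F y - F m - c / 2 * (y - m) ^ 2) =o[𝓝 m] fun y => (y - m) ^ 2 := by
  obtain ⟨ε, hε, hball⟩ := Metric.eventually_nhds_iff_ball.1 hF
  have hmem : m ∈ Metric.ball m ε := Metric.mem_ball_self hε
  have hder : ∀ y ∈ Metric.ball m ε, HasDerivWithinAt (fun y => F y - F m - c / 2 * (y - m) ^ 2)
      (F' y - c * (y - m)) (Metric.ball m ε) y := by
    intro y hy
    have h3 : HasDerivAt (fun y : ℝ => (y - m) ^ 2) (2 * (y - m)) y := by
      simpa using ((hasDerivAt_id y).sub_const m).fun_pow 2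
    refine HasDerivAt.hasDerivWithinAt ?_
    convert! ((hball y hy).sub_const (F m)).sub (h3.const_mul (c / 2)) using 1
    ring
  have hlo : (fun y => F' y - c * (y - m)) =o[𝓝[Metric.ball m ε] m] fun y => (y - m) ^ 1 := by
    refine Asymptotics.IsLittleO.mono ?_ nhdsWithin_le_nhds
    have := hasDerivAt_iff_isLittleO.1 h2
    simpa [h0, mul_comm] using this
  -- The mean value inequality integrates the first order expansion of `F'`; thus `F'` need only be
  -- differentiable at `m` itself.
  have := (convex_ball m ε).isLittleO_pow_succ_real hmem hder hlo
  rw [Metric.isOpen_ball.nhdsWithin_eq hmem] at this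
  simpa using this

lemma tendsto_mul_sub_of_critical {F F' : ℝ → ℝ} {m c d : ℝ}
    (hF : ∀ᶠ y in 𝓝 m, HasDerivAt F (F' y) y) (h0 : F' m = 0) (h2 : HasDerivAt F' c m)
    {y : ℕ → ℝ} (hy : Tendsto y atTop (𝓝 m))
    (hd : Tendsto (fun n : ℕ => (n : ℝ) * (y n - m) ^ 2) atTop (𝓝 d)) :
    Tendsto (fun n : ℕ => (n : ℝ) * (F (y n) - F m)) atTop (𝓝 (c / 2 * d)) := by
  have h3 := (isLittleO_of_hasDerivAt_critical hF h0 h2).comp_tendsto hy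
  have h4 : (fun n : ℕ => (n : ℝ) * (F (y n) - F m - c / 2 * (y n - m) ^ 2)) =o[atTop]
      fun n : ℕ => (n : ℝ) * (y n - m) ^ 2 :=
    (Asymptotics.isBigO_refl _ _).mul_isLittleO h3
  have h5 : Tendsto (fun n : ℕ => (n : ℝ) * (F (y n) - F m - c / 2 * (y n - m) ^ 2)) atTop
      (𝓝 0) := by
    have := h4.trans_isBigO (hd.isBigO_one ℝ)
    rwa [Asymptotics.isLittleO_one_iff] at this
  have := h5.add (hd.const_mul (c / 2))
  rw [zero_add] at this
  refine this.congr fun n => ?_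
  ring

/-- Second order expansion of `log (1 + y) - y` at its critical point `0`, where the second
derivative is `-1`. -/
lemma tendsto_one_add_mul_exp_neg_pow {t : ℕ → ℝ} {d : ℝ} (ht : Tendsto t atTop (𝓝 0))
    (hd : Tendsto (fun n : ℕ => (n : ℝ) * t n ^ 2) atTop (𝓝 d)) :
    Tendsto (fun n : ℕ => ((1 + t n) * Real.exp (-t n)) ^ n) atTop (𝓝 (Real.exp (-(d / 2)))) := by
  have hF : ∀ᶠ y in 𝓝 (0 : ℝ),
      HasDerivAt (fun y => Real.log (1 + y) - y) ((1 + y)⁻¹ - 1) y := by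
    filter_upwards [lt_mem_nhds (show (-1 : ℝ) < 0 by norm_num)] with y hy
    have h1 : HasDerivAt (fun y : ℝ => 1 + y) 1 y := (hasDerivAt_id y).const_add 1
    convert! (h1.log (by linarith)).sub (hasDerivAt_id y) using 1
    simp
  have h2 : HasDerivAt (fun y : ℝ => (1 + y)⁻¹ - 1) (-1) 0 := by
    have h1 : HasDerivAt (fun y : ℝ => 1 + y) 1 0 := (hasDerivAt_id _).const_add 1
    convert! (h1.inv (by norm_num)).sub_const 1 using 1
    norm_num
  have h3 := tendsto_mul_sub_of_critical hF (by norm_num) h2 ht (by simpa using hd)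
  have h4 := (Real.continuous_exp.tendsto _).comp h3
  rw [show -(d / 2) = -1 / 2 * d by ring]
  refine h4.congr' ?_
  filter_upwards [ht.eventually (lt_mem_nhds (show (-1 : ℝ) < 0 by norm_num))] with n hn
  simp only [Function.comp_apply, add_zero, Real.log_one, sub_self, sub_zero]
  rw [Real.exp_nat_mul, Real.exp_sub, Real.exp_log (by linarith), Real.exp_neg, div_eq_mul_inv]

lemma tendsto_saddleFactor {s : ℕ → ℝ} {σ : ℝ} (hs : Tendsto s atTop (𝓝 σ)) (hσ : σ ^ 2 < 1) :
    Tendsto (fun n => saddleFactor n (s n)) atTop (𝓝 (√(1 + σ ^ 2))⁻¹) := by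
  obtain ⟨q, hq1, hq2⟩ := exists_between hσ
  have hlim : (√(1 + σ ^ 2))⁻¹ =
      (√(2 * Real.pi))⁻¹ * ∫ v : ℝ, Real.exp (-(σ ^ 2 * v ^ 2 / 2)) * Real.exp (-(v ^ 2 / 2)) := by
    have : ∀ v : ℝ, Real.exp (-(σ ^ 2 * v ^ 2 / 2)) * Real.exp (-(v ^ 2 / 2)) =
        Real.exp (-((1 + σ ^ 2) / 2) * v ^ 2) := by
      intro v
      rw [← Real.exp_add]
      ring_nf
    simp_rw [this]
    rw [integral_gaussian, ← Real.sqrt_inv, ← Real.sqrt_inv, ← Real.sqrt_mul (by positivity)]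
    congr 1
    have := Real.pi_pos
    field_simp
  rw [hlim]
  refine Tendsto.const_mul _ (tendsto_integral_filter_of_dominated_convergence
    (fun v => Real.exp (-((1 - q) / 2) * v ^ 2)) (Eventually.of_forall fun n => ?_) ?_
    (integrable_exp_neg_mul_sq (by linarith)) ?_)
  · exact Continuous.aestronglyMeasurable (by fun_prop)
  · filter_upwards [(hs.pow 2).eventually (gt_mem_nhds hq1), eventually_ne_atTop 0] with n hn hn0
    exact Eventually.of_forall fun v => abs_saddleFactor_integrand_le hn0 hn.le v
  · refine Eventually.of_forall fun v => Tendsto.mul_const _ ?_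
    have h0 : Tendsto (fun n : ℕ => s n * ((√n)⁻¹ * v)) atTop (𝓝 0) := by
      have : Tendsto (fun n : ℕ => (√(n : ℝ))⁻¹) atTop (𝓝 0) :=
        (Real.tendsto_sqrt_atTop.comp tendsto_natCast_atTop_atTop).inv_tendsto_atTop
      simpa using hs.mul (this.mul_const v)
    refine tendsto_one_add_mul_exp_neg_pow h0 ?_
    refine ((hs.pow 2).mul_const (v ^ 2)).congr' ?_
    filter_upwards [eventually_ne_atTop 0] with n hn
    have h5 : (n : ℝ) * ((√n)⁻¹) ^ 2 = 1 := by
      rw [inv_pow, Real.sq_sqrt n.cast_nonneg, mul_inv_cancel₀ (by exact_mod_cast hn)]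
    linear_combination -(s n ^ 2 * v ^ 2) * h5

/-! ### Derivatives of `g`, `p⁽⁰⁾` and `p̃`. -/

lemma hasDerivAt_saddle (x : ℝ) :
    HasDerivAt saddle (-(saddle x * (1 - saddle x ^ 2) / (1 + saddle x ^ 2))) x := by
  have hs := saddle_pos x
  have hsq := saddle_sq_add x
  have he := Real.exp_pos x
  have h1 : HasDerivAt (fun x : ℝ => Real.exp (2 * x) + 4) (Real.exp (2 * x) * 2) x := by
    simpa using (((hasDerivAt_id x).const_mul 2).exp).add_const 4
  have h2 := ((h1.sqrt (by positivity)).sub (Real.hasDerivAt_exp x)).div_const 2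
  have h3 : √(Real.exp (2 * x) + 4) = 2 * saddle x + Real.exp x := by
    unfold saddle
    ring
  have h4 : Real.exp (2 * x) = Real.exp x ^ 2 := by rw [← Real.exp_nat_mul]; norm_cast
  convert! h2 using 1
  rw [h3, h4]
  -- The saddle equation removes the square root, which equals `2s + e^x`, from the derivative.
  have h5 : 1 + saddle x ^ 2 = saddle x * (2 * saddle x + Real.exp x) := by linarith
  rw [h5, show 1 - saddle x ^ 2 = Real.exp x * saddle x by linarith]
  field_simp
  ring

lemma hasDerivAt_gFun (x : ℝ) :
    HasDerivAt gFun (2 * gFun x * (1 - gFun x) / (2 - gFun x)) x := by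
  have h : gFun = fun x => 1 - saddle x ^ 2 := funext gFun_eq_one_sub_saddle_sq
  have h1 := ((hasDerivAt_saddle x).fun_pow 2).const_sub 1
  rw [← h] at h1
  convert! h1 using 1
  rw [gFun_eq_one_sub_saddle_sq, show 2 - (1 - saddle x ^ 2) = 1 + saddle x ^ 2 by ring]
  have : 1 + saddle x ^ 2 ≠ 0 := by positivity
  field_simp
  ring

lemma hasDerivAt_pZero (x : ℝ) : HasDerivAt pZero (gFun x) x := by
  have h : pZero = fun x => -(saddle x ^ 2 / 2) - Real.log (saddle x) := funext pZero_eq_saddle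
  have hs := saddle_pos x
  have h1 := (((hasDerivAt_saddle x).fun_pow 2).div_const 2).fun_neg.fun_sub
    ((hasDerivAt_saddle x).log hs.ne')
  rw [← h] at h1
  convert! h1 using 1
  rw [gFun_eq_one_sub_saddle_sq]
  have : 1 + saddle x ^ 2 ≠ 0 := by positivity
  field_simp
  ring

lemma hasDerivAt_field (h J m : ℝ) : HasDerivAt (fun m : ℝ => (2 * m - 1) * J + h) (2 * J) m := by
  simpa using ((((hasDerivAt_id m).const_mul 2).sub_const 1).mul_const J).add_const h

lemma hasDerivAt_pTilde (h J m : ℝ) :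
    HasDerivAt (pTilde h J) (2 * J * (gFun ((2 * m - 1) * J + h) - m)) m := by
  have h1 := (hasDerivAt_pZero ((2 * m - 1) * J + h)).comp m (hasDerivAt_field h J m)
  have h2 := ((hasDerivAt_id m).fun_pow 2).const_mul (-J)
  convert! h2.add h1 using 1
  simp
  ring

lemma hasDerivAt_pTilde_deriv (h J m : ℝ) :
    HasDerivAt (fun m => 2 * J * (gFun ((2 * m - 1) * J + h) - m))
      (2 * J * (2 * gFun ((2 * m - 1) * J + h) * (1 - gFun ((2 * m - 1) * J + h)) /
        (2 - gFun ((2 * m - 1) * J + h)) * (2 * J) - 1)) m :=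
  (((hasDerivAt_gFun ((2 * m - 1) * J + h)).comp m (hasDerivAt_field h J m)).sub
    (hasDerivAt_id m)).const_mul (2 * J)

lemma continuous_pTilde (h J : ℝ) : Continuous (pTilde h J) :=
  continuous_iff_continuousAt.2 fun m => (hasDerivAt_pTilde h J m).continuousAt

lemma curvature_eq (h J m : ℝ) :
    curvature h J m = 2 * J * (2 * gFun ((2 * m - 1) * J + h) * (1 - gFun ((2 * m - 1) * J + h)) /
        (2 - gFun ((2 * m - 1) * J + h)) * (2 * J) - 1) := by
  rw [curvature, iteratedDeriv_succ, iteratedDeriv_one,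
    show deriv (pTilde h J) = fun m => 2 * J * (gFun ((2 * m - 1) * J + h) - m) from
      funext fun m => (hasDerivAt_pTilde h J m).deriv]
  exact (hasDerivAt_pTilde_deriv h J m).deriv

/-! ### The global maximum points of `p̃`. -/

section MaxPoints

variable {h J : ℝ}

lemma gFun_eq_of_mem_globalMaxPoints (hJ : 0 < J) {m : ℝ} (hm : m ∈ globalMaxPoints h J) :
    gFun ((2 * m - 1) * J + h) = m := by
  have h1 : IsLocalMax (pTilde h J) m := Eventually.of_forall hm
  have h2 := h1.hasDerivAt_eq_zero (hasDerivAt_pTilde h J m)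
  have : 2 * J ≠ 0 := by positivity
  linarith [(mul_eq_zero.1 h2).resolve_left this]

lemma mem_Ioo_of_mem_globalMaxPoints (hJ : 0 < J) {m : ℝ} (hm : m ∈ globalMaxPoints h J) :
    m ∈ Ioo (0 : ℝ) 1 := by
  rw [← gFun_eq_of_mem_globalMaxPoints hJ hm]
  exact ⟨gFun_pos _, gFun_lt_one _⟩

/-- The inverse `log m - log (1 - m) / 2` of `gFun`. -/
noncomputable def gInv (m : ℝ) : ℝ :=
  Real.log m - Real.log (1 - m) / 2

lemma gInv_gFun (x : ℝ) : gInv (gFun x) = x := by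
  have h1 : gFun x = Real.exp x * saddle x := by
    linarith [saddle_sq_add x, gFun_eq_one_sub_saddle_sq x]
  rw [gInv, show 1 - gFun x = saddle x ^ 2 by linarith [gFun_eq_one_sub_saddle_sq x], h1,
    Real.log_mul (Real.exp_pos x).ne' (saddle_pos x).ne', Real.log_exp, Real.log_pow]
  push_cast
  ring

lemma gInv_strictMonoOn : StrictMonoOn gInv (Ioo 0 1) := by
  intro p hp q hq hpq
  have h1 := Real.log_lt_log hp.1 hpq
  have h2 := Real.log_lt_log (show 0 < 1 - q by linarith [hq.2]) (show 1 - q < 1 - p by linarith)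
  unfold gInv
  linarith

lemma gFun_gInv {m : ℝ} (hm : m ∈ Ioo (0 : ℝ) 1) : gFun (gInv m) = m :=
  gInv_strictMonoOn.injOn ⟨gFun_pos _, gFun_lt_one _⟩ hm (gInv_gFun _)

lemma gFun_strictMono : StrictMono gFun := by
  intro x y hxy
  by_contra! hle
  have := gInv_strictMonoOn.monotoneOn ⟨gFun_pos y, gFun_lt_one y⟩ ⟨gFun_pos x, gFun_lt_one x⟩ hle
  rw [gInv_gFun, gInv_gFun] at this
  linarith

/-- The defect `g⁻¹(m) - ((2 m - 1) J + h)` of the consistency equation. -/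
noncomputable def consistencyDefect (h J m : ℝ) : ℝ :=
  gInv m - ((2 * m - 1) * J + h)

/-- The quadratic polynomial carrying the sign of the derivative of the consistency defect. -/
def defectQuadratic (J m : ℝ) : ℝ :=
  2 - m - 4 * J * m * (1 - m)

lemma hasDerivAt_consistencyDefect (h J : ℝ) {m : ℝ} (hm : m ∈ Ioo (0 : ℝ) 1) :
    HasDerivAt (consistencyDefect h J) (defectQuadratic J m / (2 * m * (1 - m))) m := by
  have h0 : m ≠ 0 := hm.1.ne'
  have h1 : 1 - m ≠ 0 := by linarith [hm.2]
  have h2 := (((Real.hasDerivAt_log h0).sub ((((hasDerivAt_id m).const_sub 1).log h1).div_const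
    2)).sub (hasDerivAt_field h J m))
  convert! h2 using 1
  rw [defectQuadratic]
  simp only [id]
  field_simp
  ring

lemma consistencyDefect_eq_zero (hJ : 0 < J) {m : ℝ} (hm : m ∈ globalMaxPoints h J) :
    consistencyDefect h J m = 0 := by
  have := gInv_gFun ((2 * m - 1) * J + h)
  rw [gFun_eq_of_mem_globalMaxPoints hJ hm] at this
  rw [consistencyDefect, this, sub_self]

lemma lt_gFun_of_consistencyDefect_neg {m : ℝ} (hm : m ∈ Ioo (0 : ℝ) 1)
    (hd : consistencyDefect h J m < 0) : m < gFun ((2 * m - 1) * J + h) := by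
  have := gFun_strictMono (sub_neg.1 hd)
  rwa [gFun_gInv hm] at this

lemma gFun_lt_of_consistencyDefect_pos {m : ℝ} (hm : m ∈ Ioo (0 : ℝ) 1)
    (hd : 0 < consistencyDefect h J m) : gFun ((2 * m - 1) * J + h) < m := by
  have := gFun_strictMono (sub_pos.1 hd)
  rwa [gFun_gInv hm] at this

lemma strictAntiOn_consistencyDefect {p q : ℝ} (hp : 0 < p) (hq : q < 1)
    (hQ : ∀ t ∈ Ioo p q, defectQuadratic J t < 0) :
    StrictAntiOn (consistencyDefect h J) (Icc p q) := by
  refine strictAntiOn_of_deriv_neg (convex_Icc p q) (fun t ht => ?_) fun t ht => ?_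
  · exact (hasDerivAt_consistencyDefect h J
      ⟨by linarith [ht.1], by linarith [ht.2]⟩).continuousAt.continuousWithinAt
  · rw [interior_Icc] at ht
    have h0 : 0 < t := by linarith [ht.1]
    have h1 : 0 < 1 - t := by linarith [ht.2]
    rw [(hasDerivAt_consistencyDefect h J ⟨h0, by linarith⟩).deriv]
    exact div_neg_of_neg_of_pos (hQ t ht) (by positivity)

/-- Otherwise the defect would decrease from its value `0` at `m`, so `p̃' > 0` just to the right of
`m` and `m` would not be a maximum. -/
lemma exists_nonneg_right_of_mem_globalMaxPoints (hJ : 0 < J) {m c : ℝ}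
    (hm : m ∈ globalMaxPoints h J) (hmc : m < c) (hc : c < 1) :
    ∃ t ∈ Ioo m c, 0 ≤ defectQuadratic J t := by
  by_contra! hQ
  have hm0 := (mem_Ioo_of_mem_globalMaxPoints hJ hm).1
  have hanti := strictAntiOn_consistencyDefect (h := h) hm0 hc hQ
  have hmono : StrictMonoOn (pTilde h J) (Icc m c) := by
    refine strictMonoOn_of_deriv_pos (convex_Icc m c) (continuous_pTilde h J).continuousOn
      fun t ht => ?_
    rw [interior_Icc] at ht
    have h1 := hanti (left_mem_Icc.2 hmc.le) (Ioo_subset_Icc_self ht) ht.1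
    rw [consistencyDefect_eq_zero hJ hm] at h1
    have := lt_gFun_of_consistencyDefect_neg ⟨by linarith [ht.1], by linarith [ht.2]⟩ h1
    rw [(hasDerivAt_pTilde h J t).deriv]
    exact mul_pos (by positivity) (by linarith)
  exact absurd (hm c) (hmono (left_mem_Icc.2 hmc.le) (right_mem_Icc.2 hmc.le) hmc).not_ge

lemma exists_nonneg_left_of_mem_globalMaxPoints (hJ : 0 < J) {m c : ℝ}
    (hm : m ∈ globalMaxPoints h J) (hcm : c < m) (hc : 0 < c) :
    ∃ t ∈ Ioo c m, 0 ≤ defectQuadratic J t := by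
  by_contra! hQ
  have hm1 := (mem_Ioo_of_mem_globalMaxPoints hJ hm).2
  have hanti := strictAntiOn_consistencyDefect (h := h) hc hm1 hQ
  have hmono : StrictAntiOn (pTilde h J) (Icc c m) := by
    refine strictAntiOn_of_deriv_neg (convex_Icc c m) (continuous_pTilde h J).continuousOn
      fun t ht => ?_
    rw [interior_Icc] at ht
    have h1 := hanti (Ioo_subset_Icc_self ht) (right_mem_Icc.2 hcm.le) ht.2
    rw [consistencyDefect_eq_zero hJ hm] at h1
    have := gFun_lt_of_consistencyDefect_pos ⟨by linarith [ht.1], by linarith [ht.2]⟩ h1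
    rw [(hasDerivAt_pTilde h J t).deriv]
    exact mul_neg_of_pos_of_neg (by positivity) (by linarith)
  exact absurd (hm c) (hmono (left_mem_Icc.2 hcm.le) (right_mem_Icc.2 hcm.le) hcm).not_ge

/-- Strict convexity in exact form: the interpolation error of a quadratic with leading coefficient
`4J`. -/
lemma defectQuadratic_convex_identity (J p t q : ℝ) :
    (q - p) * defectQuadratic J t = (q - t) * defectQuadratic J p +
      (t - p) * defectQuadratic J q - 4 * J * ((t - p) * (q - t) * (q - p)) := by
  unfold defectQuadratic
  ring

lemma defectQuadratic_neg_of_nonpos (hJ : 0 < J) {p t q : ℝ} (hpt : p < t) (htq : t < q)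
    (hp : defectQuadratic J p ≤ 0) (hq : defectQuadratic J q ≤ 0) : defectQuadratic J t < 0 := by
  have h1 := defectQuadratic_convex_identity J p t q
  have h2 : 0 < J * ((t - p) * (q - t) * (q - p)) :=
    mul_pos hJ (mul_pos (mul_pos (by linarith) (by linarith)) (by linarith))
  have h3 : (q - t) * defectQuadratic J p ≤ 0 :=
    mul_nonpos_of_nonneg_of_nonpos (by linarith) hp
  have h4 : (t - p) * defectQuadratic J q ≤ 0 :=
    mul_nonpos_of_nonneg_of_nonpos (by linarith) hq
  by_contra! h5
  have h6 : 0 ≤ (q - p) * defectQuadratic J t := mul_nonneg (by linarith) h5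
  linarith

/-- If `Q ≥ 0` throughout, the defect is monotone with zero end values, hence vanishes in between.
Then `Q` vanishes on an interval, contradicting strict convexity, which is tested at three points.
-/
lemma exists_defectQuadratic_neg (hJ : 0 < J) {m₁ m₂ : ℝ} (h1 : m₁ ∈ globalMaxPoints h J)
    (h2 : m₂ ∈ globalMaxPoints h J) (hlt : m₁ < m₂) :
    ∃ c ∈ Ioo m₁ m₂, defectQuadratic J c < 0 := by
  by_contra! hQ
  have hm1 := mem_Ioo_of_mem_globalMaxPoints hJ h1
  have hm2 := mem_Ioo_of_mem_globalMaxPoints hJ h2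
  have hmem : ∀ t ∈ Icc m₁ m₂, t ∈ Ioo (0 : ℝ) 1 := fun t ht =>
    ⟨by linarith [ht.1, hm1.1], by linarith [ht.2, hm2.2]⟩
  have hmono : MonotoneOn (consistencyDefect h J) (Icc m₁ m₂) := by
    refine monotoneOn_of_deriv_nonneg (convex_Icc _ _) (fun t ht => ?_) (fun t ht => ?_)
      fun t ht => ?_
    · exact (hasDerivAt_consistencyDefect h J (hmem t ht)).continuousAt.continuousWithinAt
    · exact (hasDerivAt_consistencyDefect h J
        (hmem t (interior_subset ht))).differentiableAt.differentiableWithinAt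
    · have ht' := hmem t (interior_subset ht)
      rw [interior_Icc] at ht
      rw [(hasDerivAt_consistencyDefect h J ht').deriv]
      exact div_nonneg (hQ t ht) (mul_nonneg (by linarith [ht'.1]) (by linarith [ht'.2]))
  have hzero : ∀ t ∈ Ioo m₁ m₂, consistencyDefect h J t = 0 := by
    intro t ht
    have h3 := hmono (left_mem_Icc.2 hlt.le) (Ioo_subset_Icc_self ht) ht.1.le
    have h4 := hmono (Ioo_subset_Icc_self ht) (right_mem_Icc.2 hlt.le) ht.2.le
    rw [consistencyDefect_eq_zero hJ h1] at h3
    rw [consistencyDefect_eq_zero hJ h2] at h4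
    exact le_antisymm h4 h3
  have hQ0 : ∀ t ∈ Ioo m₁ m₂, defectQuadratic J t = 0 := by
    intro t ht
    have ht' := hmem t (Ioo_subset_Icc_self ht)
    have h3 : consistencyDefect h J =ᶠ[𝓝 t] fun _ => 0 := by
      filter_upwards [isOpen_Ioo.mem_nhds ht] with y hy using hzero y hy
    have h4 := (hasDerivAt_consistencyDefect h J ht').unique
      ((hasDerivAt_const t (0 : ℝ)).congr_of_eventuallyEq h3)
    refine (div_eq_zero_iff.1 h4).resolve_right ?_
    exact (mul_pos (by linarith [ht'.1]) (by linarith [ht'.2])).ne'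
  have hmid : (m₁ + m₂) / 2 ∈ Ioo m₁ m₂ := ⟨by linarith, by linarith⟩
  have hl : (3 * m₁ + m₂) / 4 ∈ Ioo m₁ m₂ := ⟨by linarith, by linarith⟩
  have hr : (m₁ + 3 * m₂) / 4 ∈ Ioo m₁ m₂ := ⟨by linarith, by linarith⟩
  have := defectQuadratic_neg_of_nonpos hJ (show (3 * m₁ + m₂) / 4 < (m₁ + m₂) / 2 by linarith)
    (show (m₁ + m₂) / 2 < (m₁ + 3 * m₂) / 4 by linarith) (hQ0 _ hl).le (hQ0 _ hr).le
  linarith [hQ0 _ hmid]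

/-- If `Q ≤ 0` at one of the maxima, convexity and a point between them with `Q < 0` would make `Q`
negative on the whole gap, which the one-sided lemmas exclude. -/
lemma defectQuadratic_pos_of_lt (hJ : 0 < J) {m₁ m₂ : ℝ} (h1 : m₁ ∈ globalMaxPoints h J)
    (h2 : m₂ ∈ globalMaxPoints h J) (hlt : m₁ < m₂) :
    0 < defectQuadratic J m₁ ∧ 0 < defectQuadratic J m₂ := by
  obtain ⟨c, hc, hQ⟩ := exists_defectQuadratic_neg hJ h1 h2 hlt
  have hm1 := mem_Ioo_of_mem_globalMaxPoints hJ h1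
  have hm2 := mem_Ioo_of_mem_globalMaxPoints hJ h2
  constructor
  · by_contra! hle
    obtain ⟨t, ht, ht'⟩ := exists_nonneg_right_of_mem_globalMaxPoints hJ h1 hc.1
      (hc.2.trans hm2.2)
    exact absurd ht' (defectQuadratic_neg_of_nonpos hJ ht.1 ht.2 hle hQ.le).not_ge
  · by_contra! hle
    obtain ⟨t, ht, ht'⟩ := exists_nonneg_left_of_mem_globalMaxPoints hJ h2 hc.2
      (hm1.1.trans hc.1)
    exact absurd ht' (defectQuadratic_neg_of_nonpos hJ ht.1 ht.2 hQ.le hle).not_ge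

lemma not_three_globalMaxPoints (hJ : 0 < J) {m₁ m₂ m₃ : ℝ} (h1 : m₁ ∈ globalMaxPoints h J)
    (h2 : m₂ ∈ globalMaxPoints h J) (h3 : m₃ ∈ globalMaxPoints h J) (h12 : m₁ < m₂)
    (h23 : m₂ < m₃) : False := by
  obtain ⟨c, hc, hQ⟩ := exists_defectQuadratic_neg hJ h1 h2 h12
  obtain ⟨d, hd, hQ'⟩ := exists_defectQuadratic_neg hJ h2 h3 h23
  exact absurd (defectQuadratic_pos_of_lt hJ h1 h2 h12).2
    (defectQuadratic_neg_of_nonpos hJ hc.2 hd.1 hQ.le hQ'.le).not_gt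

lemma globalMaxPoints_eq_pair (hJ : 0 < J) {m₁ m₂ : ℝ} (h1 : m₁ ∈ globalMaxPoints h J)
    (h2 : m₂ ∈ globalMaxPoints h J) (h12 : m₁ < m₂) : globalMaxPoints h J = {m₁, m₂} := by
  refine Subset.antisymm (fun m hm => ?_) (by rintro m (rfl | rfl) <;> assumption)
  by_contra! hne
  simp only [mem_insert_iff, mem_singleton_iff, not_or] at hne
  rcases lt_or_gt_of_ne hne.1 with h3 | h3
  · exact not_three_globalMaxPoints hJ hm h1 h2 h3 h12
  · rcases lt_or_gt_of_ne hne.2 with h4 | h4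
    · exact not_three_globalMaxPoints hJ h1 hm h2 h3 h4
    · exact not_three_globalMaxPoints hJ h1 h2 hm h12 h4

/-- At a maximum `g = m`, so the curvature equals `-2J Q(m) / (2 - m)`. -/
lemma curvature_neg_of_defectQuadratic_pos (hJ : 0 < J) {m : ℝ} (hm : m ∈ globalMaxPoints h J)
    (hQ : 0 < defectQuadratic J m) : curvature h J m < 0 := by
  have hm1 := mem_Ioo_of_mem_globalMaxPoints hJ hm
  rw [curvature_eq, gFun_eq_of_mem_globalMaxPoints hJ hm]
  refine mul_neg_of_pos_of_neg (by positivity) ?_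
  have h2 : 0 < 2 - m := by linarith [hm1.2]
  rw [sub_neg, div_mul_eq_mul_div, div_lt_one h2]
  unfold defectQuadratic at hQ
  linarith

/-- Drop `-s²/2` from `p⁽⁰⁾ = -s²/2 + log (1/s)` and use `1/s = e^x + s ≤ e^x + 1`. -/
lemma pZero_le_log (x : ℝ) : pZero x ≤ Real.log (1 + Real.exp x) := by
  have hs := saddle_pos x
  have h1 : (saddle x)⁻¹ ≤ 1 + Real.exp x := by
    rw [inv_le_iff_one_le_mul₀ hs]
    nlinarith [saddle_sq_add x, saddle_lt_one x]
  rw [pZero_eq_saddle, sub_eq_add_neg, ← Real.log_inv]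
  have := Real.log_le_log (inv_pos.2 hs) h1
  nlinarith [sq_nonneg (saddle x)]

lemma pTilde_le_log (h J m : ℝ) :
    pTilde h J m ≤ -J * m ^ 2 + Real.log (1 + Real.exp ((2 * m - 1) * J + h)) :=
  add_le_add_right (pZero_le_log _) _

/-- `p⁽⁰⁾` grows at most linearly, so `-J m²` wins. -/
lemma tendsto_pTilde_cocompact (hJ : 0 < J) : Tendsto (pTilde h J) (cocompact ℝ) atBot := by
  have hlog : ∀ x : ℝ, Real.log (1 + Real.exp x) ≤ 1 + |x| := by
    intro x
    rw [Real.log_le_iff_le_exp (by positivity), Real.exp_add]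
    have h1 : Real.exp x ≤ Real.exp |x| := Real.exp_le_exp.2 (le_abs_self x)
    have h2 : 1 ≤ Real.exp |x| := Real.one_le_exp (abs_nonneg x)
    nlinarith [Real.add_one_le_exp 1]
  have hle : ∀ m : ℝ, pTilde h J m ≤ -(‖m‖ * (J * ‖m‖ - 2 * J)) + (1 + J + |h|) := by
    intro m
    have h1 := pTilde_le_log h J m
    have h2 := hlog ((2 * m - 1) * J + h)
    have h3 : |(2 * m - 1) * J + h| ≤ (2 * |m| + 1) * J + |h| := by
      refine (abs_add_le _ _).trans (add_le_add_left ?_ _)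
      rw [abs_mul, abs_of_pos hJ]
      refine mul_le_mul_of_nonneg_right ((abs_sub _ _).trans ?_) hJ.le
      rw [abs_mul]
      norm_num
    have h4 : m ^ 2 = |m| * |m| := by rw [← sq, sq_abs]
    rw [Real.norm_eq_abs]
    rw [h4] at h1
    linarith
  refine tendsto_atBot_mono hle ?_
  have h1 : Tendsto (fun m : ℝ => ‖m‖) (cocompact ℝ) atTop := tendsto_norm_cocompact_atTop
  have h2 : Tendsto (fun m : ℝ => J * ‖m‖ - 2 * J) (cocompact ℝ) atTop :=
    tendsto_atTop_add_const_right _ _ (h1.const_mul_atTop hJ)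
  exact tendsto_atBot_add_const_right _ _ (tendsto_neg_atTop_atBot.comp (h1.atTop_mul_atTop₀ h2))

lemma exists_forall_ge_of_isClosed {P : ℝ → ℝ} (hP : Continuous P)
    (hlim : Tendsto P (cocompact ℝ) atBot) {E : Set ℝ} (hE : IsClosed E) (hne : E.Nonempty) :
    ∃ m ∈ E, ∀ y ∈ E, P y ≤ P m := by
  obtain ⟨y₀, hy₀⟩ := hne
  exact hP.continuousOn.exists_isMaxOn' hE hy₀
    ((hlim.eventually (eventually_le_atBot (P y₀))).filter_mono inf_le_left)

lemma globalMaxPoints_nonempty (h : ℝ) (hJ : 0 < J) : (globalMaxPoints h J).Nonempty := by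
  obtain ⟨m, -, hm⟩ := exists_forall_ge_of_isClosed (continuous_pTilde h J)
    (tendsto_pTilde_cocompact hJ) isClosed_univ univ_nonempty
  exact ⟨m, fun y => hm y (mem_univ y)⟩

end MaxPoints

/-! ### Laplace's method. -/

/-- The data of a one-dimensional Laplace asymptotics: an exponent `P ≤ 0` and prefactors `R n`
that are dominated by `B` and converge continuously to `R∞`. -/
structure LaplaceData (P B Rlim : ℝ → ℝ) (R : ℕ → ℝ → ℝ) : Prop where
  continuous_exponent : Continuous P
  nonpos : ∀ y, P y ≤ 0
  tendsto_exponent : Tendsto P (cocompact ℝ) atBot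
  continuous_bound : Continuous B
  integrable : Integrable fun y => Real.exp (P y) * B y
  measurable : ∀ n, n ≠ 0 → Measurable (R n)
  nonneg : ∀ n, n ≠ 0 → ∀ y, 0 ≤ R n y
  le_bound : ∀ n, n ≠ 0 → ∀ y, R n y ≤ B y
  tendsto : ∀ (y : ℕ → ℝ) (z : ℝ), Tendsto y atTop (𝓝 z) →
    Tendsto (fun n => R n (y n)) atTop (𝓝 (Rlim z))

namespace LaplaceData

variable {P B Rlim : ℝ → ℝ} {R : ℕ → ℝ → ℝ}

/-- One of the `n` factors `e^P` is kept to make `B` integrable; the other `n - 1` give the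
exponential decay. -/
lemma abs_integrand_le (hL : LaplaceData P B Rlim R) {f : ℝ → ℝ} {C : ℝ} (hC : ∀ y, |f y| ≤ C)
    {n : ℕ} (hn : n ≠ 0) {δ : ℝ} {y : ℝ} (hy : P y ≤ -δ) :
    |f y * (Real.exp (n * P y) * R n y)| ≤
      Real.exp (-(n - 1) * δ) * (C * (Real.exp (P y) * B y)) := by
  have h0 := hL.nonneg n hn y
  have hn1 : (1 : ℝ) ≤ n := by exact_mod_cast Nat.one_le_iff_ne_zero.2 hn
  have hC0 : 0 ≤ C := (abs_nonneg _).trans (hC y)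
  rw [abs_mul, abs_mul, abs_of_nonneg h0, abs_of_pos (Real.exp_pos _)]
  have h1 : Real.exp (n * P y) ≤ Real.exp (-(n - 1) * δ) * Real.exp (P y) := by
    rw [← Real.exp_add, Real.exp_le_exp]
    nlinarith
  calc |f y| * (Real.exp (n * P y) * R n y)
      ≤ C * ((Real.exp (-(n - 1) * δ) * Real.exp (P y)) * B y) := by
        gcongr
        · exact hC y
        · exact hL.le_bound n hn y
    _ = _ := by ring

lemma integrable_integrand (hL : LaplaceData P B Rlim R) {f : ℝ → ℝ} (hf : Measurable f) {C : ℝ}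
    (hC : ∀ y, |f y| ≤ C) {n : ℕ} (hn : n ≠ 0) :
    Integrable fun y => f y * (Real.exp (n * P y) * R n y) := by
  have hP := hL.continuous_exponent.measurable
  have hR := hL.measurable n hn
  refine (hL.integrable.const_mul C).mono' (by fun_prop) (Eventually.of_forall fun y => ?_)
  simpa using hL.abs_integrand_le hC hn (δ := 0) (by simpa using hL.nonpos y)

/-- Closed sets without maximum points do not contribute. -/
lemma tendsto_setIntegral_zero (hL : LaplaceData P B Rlim R) {E : Set ℝ} (hE : IsClosed E)
    (hPE : ∀ y ∈ E, P y < 0) {f : ℝ → ℝ} {C : ℝ} (hC : ∀ y, |f y| ≤ C) :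
    Tendsto (fun n : ℕ => √n * ∫ y in E, f y * (Real.exp (n * P y) * R n y)) atTop (𝓝 0) := by
  rcases E.eq_empty_or_nonempty with rfl | hne
  · simp
  obtain ⟨m, hm, hmax⟩ :=
    exists_forall_ge_of_isClosed hL.continuous_exponent hL.tendsto_exponent hE hne
  set δ := -P m with hδ
  have hδ0 : 0 < δ := neg_pos.2 (hPE m hm)
  set K := ∫ y in E, C * (Real.exp (P y) * B y)
  have hle : ∀ᶠ n : ℕ in atTop, ‖√n * ∫ y in E, f y * (Real.exp (n * P y) * R n y)‖ ≤
      (Real.exp δ * K) * ((n : ℝ) ^ (1 : ℕ) * Real.exp (-δ * n)) := by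
    filter_upwards [eventually_ne_atTop 0] with n hn
    have hn1 : (1 : ℝ) ≤ n := by exact_mod_cast Nat.one_le_iff_ne_zero.2 hn
    have h1 : ‖∫ y in E, f y * (Real.exp (n * P y) * R n y)‖ ≤
        ∫ y in E, Real.exp (-(n - 1) * δ) * (C * (Real.exp (P y) * B y)) := by
      refine norm_integral_le_of_norm_le ((hL.integrable.const_mul C).const_mul _).integrableOn ?_
      filter_upwards [ae_restrict_mem hE.measurableSet] with y hy
      exact hL.abs_integrand_le hC hn (by rw [hδ, neg_neg]; exact hmax y hy)
    rw [integral_const_mul] at h1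
    have h2 : √(n : ℝ) ≤ n := Real.sqrt_le_self_iff.2 (Or.inr hn1)
    rw [norm_mul, Real.norm_of_nonneg (Real.sqrt_nonneg _)]
    calc _ ≤ (n : ℝ) * (Real.exp (-(n - 1) * δ) * K) := by gcongr
      _ = _ := by
        rw [show -((n : ℝ) - 1) * δ = δ + -δ * n by ring, Real.exp_add]
        ring
  refine squeeze_zero_norm' hle ?_
  have h3 := (tendsto_rpow_mul_exp_neg_mul_atTop_nhds_zero 1 δ hδ0).comp
    tendsto_natCast_atTop_atTop
  simpa [Function.comp_def] using h3.const_mul (Real.exp δ * K)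

/-- Contribution of shrinking neighbourhoods of a maximum point at the scale `n^{-1/2}`. -/
lemma tendsto_setIntegral_of_dominated (hL : LaplaceData P B Rlim R) {P' : ℝ → ℝ} {m c : ℝ}
    (hP : ∀ᶠ y in 𝓝 m, HasDerivAt P (P' y) y) (hm : P m = 0) (h0 : P' m = 0)
    (h2 : HasDerivAt P' c m) {f : ℝ → ℝ} (hf : Continuous f) {C : ℝ} (hC : ∀ y, |f y| ≤ C)
    {U : ℕ → Set ℝ} {Ulim : Set ℝ} {G : ℝ → ℝ} (hU : ∀ n, MeasurableSet (U n))
    (hUlim : MeasurableSet Ulim) (hU1 : ∀ n, U n ⊆ Metric.closedBall m 1) (hG : Integrable G)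
    (hG0 : ∀ u, 0 ≤ G u)
    (hUG : ∀ n, n ≠ 0 → ∀ u, m + (√n)⁻¹ * u ∈ U n → Real.exp (n * P (m + (√n)⁻¹ * u)) ≤ G u)
    (hUU : ∀ u, ∀ᶠ n : ℕ in atTop, m + (√n)⁻¹ * u ∈ U n ↔ u ∈ Ulim) :
    Tendsto (fun n : ℕ => √n * ∫ y in U n, f y * (Real.exp (n * P y) * R n y)) atTop
      (𝓝 (f m * Rlim m * ∫ u in Ulim, Real.exp (c / 2 * u ^ 2))) := by
  have hC0 : 0 ≤ C := (abs_nonneg _).trans (hC 0)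
  obtain ⟨K, hK⟩ := (isCompact_closedBall m 1).exists_bound_of_continuousOn
    hL.continuous_bound.continuousOn
  set F : ℕ → ℝ → ℝ := fun n => (U n).indicator fun y => f y * (Real.exp (n * P y) * R n y)
  -- The substitution `y = m + u/√n`. It needs no restriction on `n`: for `n = 0` both sides are
  -- zero by convention.
  have hscale : ∀ᶠ n : ℕ in atTop, ∫ u, F n (m + (√n)⁻¹ * u) =
      √n * ∫ y in U n, f y * (Real.exp (n * P y) * R n y) := by
    filter_upwards with n
    rw [Measure.integral_comp_mul_left (fun u => F n (m + u)), integral_add_left_eq_self,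
      integral_indicator (hU n), inv_inv, abs_of_nonneg (Real.sqrt_nonneg _), smul_eq_mul]
  refine Tendsto.congr' hscale ?_
  rw [← integral_const_mul, ← integral_indicator hUlim]
  have hpt : ∀ u : ℝ, Tendsto (fun n : ℕ => m + (√n)⁻¹ * u) atTop (𝓝 m) := by
    intro u
    have : Tendsto (fun n : ℕ => (√(n : ℝ))⁻¹) atTop (𝓝 0) :=
      (Real.tendsto_sqrt_atTop.comp tendsto_natCast_atTop_atTop).inv_tendsto_atTop
    simpa using (this.mul_const u).const_add m
  refine tendsto_integral_filter_of_dominated_convergence (fun u => C * (G u * K)) ?_ ?_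
    ((hG.mul_const K).const_mul C) ?_
  · filter_upwards [eventually_ne_atTop 0] with n hn
    have hP := hL.continuous_exponent.measurable
    have hR := hL.measurable n hn
    have hf' := hf.measurable
    have : Measurable (F n) := Measurable.indicator (by fun_prop) (hU n)
    exact (this.comp (by fun_prop)).aestronglyMeasurable
  · filter_upwards [eventually_ne_atTop 0] with n hn
    refine Eventually.of_forall fun u => ?_
    by_cases hu : m + (√n)⁻¹ * u ∈ U n
    · have hb := (le_abs_self _).trans (hK _ (hU1 n hu))
      simp only [F, indicator_of_mem hu, norm_mul, Real.norm_eq_abs, Real.abs_exp,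
        abs_of_nonneg (hL.nonneg n hn _)]
      have h3 := hUG n hn u hu
      have h4 := (hL.le_bound n hn (m + (√n)⁻¹ * u)).trans hb
      have h5 := hL.nonneg n hn (m + (√n)⁻¹ * u)
      have h6 := hG0 u
      gcongr
      exact hC _
    · have hK0 : 0 ≤ K := (norm_nonneg _).trans (hK m (by simp))
      simp only [F, indicator_of_notMem hu, norm_zero]
      exact mul_nonneg hC0 (mul_nonneg (hG0 u) hK0)
  · refine Eventually.of_forall fun u => ?_
    have hlim : Tendsto (fun n : ℕ => f (m + (√n)⁻¹ * u) *
        (Real.exp (n * P (m + (√n)⁻¹ * u)) * R n (m + (√n)⁻¹ * u))) atTop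
        (𝓝 (f m * (Real.exp (c / 2 * u ^ 2) * Rlim m))) := by
      refine ((hf.tendsto m).comp (hpt u)).mul (Tendsto.mul ?_ (hL.tendsto _ _ (hpt u)))
      refine (Real.continuous_exp.tendsto _).comp ?_
      have := tendsto_mul_sub_of_critical hP h0 h2 (hpt u) (d := u ^ 2) ?_
      · simpa [hm] using this
      · refine tendsto_const_nhds.congr' ?_
        filter_upwards [eventually_ne_atTop 0] with n hn
        have h5 : (n : ℝ) * ((√n)⁻¹) ^ 2 = 1 := by
          rw [inv_pow, Real.sq_sqrt n.cast_nonneg, mul_inv_cancel₀ (by exact_mod_cast hn)]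
        linear_combination (-u ^ 2) * h5
    by_cases hu : u ∈ Ulim
    · rw [indicator_of_mem hu, show f m * Rlim m * Real.exp (c / 2 * u ^ 2) =
        f m * (Real.exp (c / 2 * u ^ 2) * Rlim m) by ring]
      refine hlim.congr' ?_
      filter_upwards [hUU u] with n hn
      simp only [F]
      rw [indicator_of_mem (hn.2 hu)]
    · rw [indicator_of_notMem hu]
      refine tendsto_const_nhds.congr' ?_
      filter_upwards [hUU u] with n hn
      simp only [F]
      rw [indicator_of_notMem fun h => hu (hn.1 h)]

/-- Contribution of a nondegenerate maximum point. -/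
lemma tendsto_setIntegral_ball (hL : LaplaceData P B Rlim R) {P' : ℝ → ℝ} {m c : ℝ}
    (hP : ∀ᶠ y in 𝓝 m, HasDerivAt P (P' y) y) (hm : P m = 0) (h0 : P' m = 0)
    (h2 : HasDerivAt P' c m) (hc : c < 0) :
    ∃ ε₀ > 0, ∀ ε, 0 < ε → ε ≤ ε₀ → ∀ f : ℝ → ℝ, Continuous f → ∀ C, (∀ y, |f y| ≤ C) →
      Tendsto (fun n : ℕ => √n * ∫ y in Metric.ball m ε, f y * (Real.exp (n * P y) * R n y)) atTop
        (𝓝 (f m * Rlim m * √(2 * Real.pi / -c))) := by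
  -- An error of at most `-c/4 (y - m)²` spends half of the leading term `c/2 (y - m)²` and leaves a
  -- Gaussian bound.
  have hev := (isLittleO_of_hasDerivAt_critical hP h0 h2).def (show 0 < -c / 4 by linarith)
  obtain ⟨ε₁, hε₁, hball⟩ := Metric.eventually_nhds_iff_ball.1 hev
  have hquad : ∀ y ∈ Metric.ball m ε₁, P y ≤ c / 4 * (y - m) ^ 2 := by
    intro y hy
    have := (le_abs_self _).trans (hball y hy)
    rw [hm, Real.norm_of_nonneg (sq_nonneg _)] at this
    linarith
  refine ⟨min ε₁ 1, by positivity, fun ε hε hε' f hf C hC => ?_⟩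
  have hint : ∫ u in univ, Real.exp (c / 2 * u ^ 2) = √(2 * Real.pi / -c) := by
    rw [setIntegral_univ, show c / 2 = -(-c / 2) by ring, integral_gaussian]
    congr 1
    have : c ≠ 0 := hc.ne
    field_simp
  rw [← hint]
  refine hL.tendsto_setIntegral_of_dominated hP hm h0 h2 hf hC (U := fun _ => Metric.ball m ε)
    (G := fun u => Real.exp (-(-c / 4) * u ^ 2)) (fun _ => measurableSet_ball)
    MeasurableSet.univ (fun _ => ?_) (integrable_exp_neg_mul_sq (by linarith))
    (fun u => (Real.exp_pos _).le) ?_ ?_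
  · exact Metric.ball_subset_closedBall.trans
      (Metric.closedBall_subset_closedBall (hε'.trans (min_le_right _ _)))
  · intro n hn u hu
    have h3 := hquad _ (Metric.ball_subset_ball (hε'.trans (min_le_left _ _)) hu)
    have h5 : (n : ℝ) * ((√n)⁻¹) ^ 2 = 1 := by
      rw [inv_pow, Real.sq_sqrt n.cast_nonneg, mul_inv_cancel₀ (by exact_mod_cast hn)]
    rw [Real.exp_le_exp]
    calc (n : ℝ) * P (m + (√n)⁻¹ * u)
        ≤ n * (c / 4 * (m + (√n)⁻¹ * u - m) ^ 2) := by gcongr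
      _ = _ := by linear_combination (c / 4 * u ^ 2) * h5
  · intro u
    have hpt : Tendsto (fun n : ℕ => m + (√n)⁻¹ * u) atTop (𝓝 m) := by
      have : Tendsto (fun n : ℕ => (√(n : ℝ))⁻¹) atTop (𝓝 0) :=
        (Real.tendsto_sqrt_atTop.comp tendsto_natCast_atTop_atTop).inv_tendsto_atTop
      simpa using (this.mul_const u).const_add m
    filter_upwards [hpt.eventually (Metric.ball_mem_nhds m hε)] with n hn
    simpa using hn

/-- The total mass decays at most like `n^{-1/2}`. -/
lemma exists_le_integral (hL : LaplaceData P B Rlim R) {P' : ℝ → ℝ} {m c : ℝ}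
    (hP : ∀ᶠ y in 𝓝 m, HasDerivAt P (P' y) y) (hm : P m = 0) (h0 : P' m = 0)
    (h2 : HasDerivAt P' c m) (hR : 0 < Rlim m) :
    ∃ κ > 0, ∀ᶠ n : ℕ in atTop, κ ≤ √n * ∫ y, Real.exp (n * P y) * R n y := by
  -- On the scale `n^(-1/2)` these balls become the unit ball, where `e^(nP) ≤ 1` is already a
  -- dominating function; hence no condition on the sign of `c`.
  have hlim := hL.tendsto_setIntegral_of_dominated hP hm h0 h2 (f := fun _ => 1) continuous_const
    (C := 1) (by simp) (U := fun n => Metric.ball m (min 1 (√n)⁻¹)) (Ulim := Metric.ball 0 1)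
    (G := (Metric.ball 0 1).indicator 1) (fun _ => measurableSet_ball) measurableSet_ball
    (fun n => Metric.ball_subset_closedBall.trans
      (Metric.closedBall_subset_closedBall (min_le_left _ _)))
    ((integrable_indicator_iff measurableSet_ball).2
      (integrableOn_const (by simp) (by simp)))
    (fun u => indicator_nonneg (by simp) u) ?_ ?_
  · have hI : 0 < ∫ u in Metric.ball (0 : ℝ) 1, Real.exp (c / 2 * u ^ 2) := by
      rw [setIntegral_pos_iff_support_of_nonneg_ae
        (Eventually.of_forall fun u => (Real.exp_pos _).le)]
      · have : Function.support (fun u : ℝ => Real.exp (c / 2 * u ^ 2)) = univ :=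
          Function.support_eq_univ fun u => (Real.exp_pos _).ne'
        rw [this, univ_inter]
        exact Metric.measure_ball_pos _ _ one_pos
      · have : Continuous fun u : ℝ => Real.exp (c / 2 * u ^ 2) := by fun_prop
        exact (this.integrableOn_Icc (a := -1) (b := 1)).mono_set
          (by rw [Real.ball_eq_Ioo]; simpa using Ioo_subset_Icc_self)
    simp only [one_mul] at hlim
    have hpos := mul_pos hR hI
    refine ⟨_, half_pos hpos, ?_⟩
    filter_upwards [hlim.eventually (lt_mem_nhds (half_lt_self hpos)), eventually_ne_atTop 0]
      with n hn hn0
    refine hn.le.trans (mul_le_mul_of_nonneg_left ?_ (Real.sqrt_nonneg _))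
    refine setIntegral_le_integral ?_ (Eventually.of_forall fun y =>
      mul_nonneg (Real.exp_pos _).le (hL.nonneg n hn0 y))
    simpa using hL.integrable_integrand (f := fun _ => 1) measurable_const (C := 1) (by simp) hn0
  · intro n hn u hu
    have hn1 : 0 < (√(n : ℝ))⁻¹ := inv_pos.2 (Real.sqrt_pos.2 (by positivity))
    have hu1 : u ∈ Metric.ball (0 : ℝ) 1 := by
      simp only [Metric.mem_ball, dist_self_add_left, norm_mul, norm_inv, lt_min_iff] at hu
      rw [Real.norm_of_nonneg (Real.sqrt_nonneg _)] at hu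
      have h3 := hu.2
      rw [mul_lt_iff_lt_one_right hn1] at h3
      simpa using h3
    rw [indicator_of_mem hu1, Pi.one_apply, Real.exp_le_one_iff]
    exact mul_nonpos_of_nonneg_of_nonpos n.cast_nonneg (hL.nonpos _)
  · intro u
    filter_upwards [eventually_ne_atTop 0] with n hn
    have hn1 : 0 < (√(n : ℝ))⁻¹ := inv_pos.2 (Real.sqrt_pos.2 (by positivity))
    have hn2 : (√(n : ℝ))⁻¹ ≤ 1 :=
      inv_le_one_of_one_le₀ (Real.one_le_sqrt.2 (by exact_mod_cast Nat.one_le_iff_ne_zero.2 hn))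
    simp only [Metric.mem_ball, dist_self_add_left, norm_mul, norm_inv, min_eq_right hn2,
      dist_zero_right]
    rw [Real.norm_of_nonneg (Real.sqrt_nonneg _), mul_lt_iff_lt_one_right hn1]

/-- Concentration at a unique maximum point. -/
theorem tendsto_ratio_of_unique (hL : LaplaceData P B Rlim R) {P' : ℝ → ℝ} {m c : ℝ}
    (hP : ∀ᶠ y in 𝓝 m, HasDerivAt P (P' y) y) (hm : P m = 0) (h0 : P' m = 0)
    (h2 : HasDerivAt P' c m) (hR : 0 < Rlim m) (huniq : ∀ y, y ≠ m → P y < 0)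
    {f : ℝ → ℝ} (hf : Continuous f) {C : ℝ} (hC : ∀ y, |f y| ≤ C) :
    Tendsto (fun n : ℕ => (∫ y, f y * (Real.exp (n * P y) * R n y)) /
      ∫ y, Real.exp (n * P y) * R n y) atTop (𝓝 (f m)) := by
  obtain ⟨κ, hκ, hlow⟩ := hL.exists_le_integral hP hm h0 h2 hR
  rw [Metric.tendsto_nhds]
  intro η hη
  -- Off `E` the integrand errs by at most `η/2` times the weight. On the closed set `E`, which
  -- misses `m`, the weight is negligible against `κ n^(-1/2)`.
  set E : Set ℝ := {y | η / 2 ≤ |f y - f m|} with hE_def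
  have hE : IsClosed E := isClosed_le continuous_const (by fun_prop)
  have hPE : ∀ y ∈ E, P y < 0 := fun y hy => huniq y fun h => by
    rw [hE_def, mem_ofPred_eq, h, sub_self, abs_zero] at hy
    linarith
  have htail := hL.tendsto_setIntegral_zero hE hPE (f := fun _ => 2 * C) (C := |2 * C|)
    (fun _ => le_rfl)
  filter_upwards [hlow, eventually_ne_atTop 0,
    htail.eventually (gt_mem_nhds (show 0 < η / 2 * κ by positivity))] with n hn hn0 ht
  have hw : ∀ y, 0 ≤ Real.exp (n * P y) * R n y := fun y =>
    mul_nonneg (Real.exp_pos _).le (hL.nonneg n hn0 y)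
  have hn1 : 0 < √(n : ℝ) := Real.sqrt_pos.2 (by positivity)
  have i1 : Integrable fun y => Real.exp (n * P y) * R n y := by
    simpa using hL.integrable_integrand (f := fun _ => 1) measurable_const (C := 1) (by simp) hn0
  have if' := hL.integrable_integrand hf.measurable hC hn0
  set I := ∫ y, Real.exp (n * P y) * R n y
  have hI : 0 < I := by
    by_contra! hle
    have := mul_nonpos_of_nonneg_of_nonpos hn1.le hle
    linarith
  have hdiff : |(∫ y, f y * (Real.exp (n * P y) * R n y)) - f m * I| ≤
      η / 2 * I + ∫ y in E, 2 * C * (Real.exp (n * P y) * R n y) := by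
    rw [← integral_const_mul, ← integral_sub if' (i1.const_mul _), ← integral_const_mul,
      ← integral_indicator hE.measurableSet, ← integral_add (i1.const_mul _)
        ((i1.const_mul _).indicator hE.measurableSet), ← Real.norm_eq_abs]
    refine norm_integral_le_of_norm_le ((i1.const_mul _).add
        ((i1.const_mul _).indicator hE.measurableSet)) (Eventually.of_forall fun y => ?_)
    rw [← sub_mul, norm_mul, Real.norm_of_nonneg (hw y), Real.norm_eq_abs]
    by_cases hy : y ∈ E
    · simp only [indicator_of_mem hy]
      have h3 : |f y - f m| ≤ 2 * C := (abs_sub _ _).trans (by linarith [hC y, hC m])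
      have h4 := mul_le_mul_of_nonneg_right h3 (hw y)
      have h5 : 0 ≤ η / 2 * (Real.exp (n * P y) * R n y) := mul_nonneg (by linarith) (hw y)
      linarith
    · simp only [indicator_of_notMem hy, add_zero]
      exact mul_le_mul_of_nonneg_right (not_le.1 hy).le (hw y)
  have hT : ∫ y in E, 2 * C * (Real.exp (n * P y) * R n y) < η / 2 * I := by
    refine lt_of_mul_lt_mul_left (ht.trans_le ?_) hn1.le
    nlinarith
  rw [Real.dist_eq, div_sub' hI.ne', abs_div, abs_of_pos hI, div_lt_iff₀ hI, mul_comm I]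
  linarith

/-- Laplace asymptotics with two nondegenerate maximum points. -/
theorem tendsto_integral_of_pair (hL : LaplaceData P B Rlim R) {P' : ℝ → ℝ} {m₁ m₂ c₁ c₂ : ℝ}
    (hP : ∀ y, HasDerivAt P (P' y) y) (hm₁ : P m₁ = 0) (hm₂ : P m₂ = 0) (h01 : P' m₁ = 0)
    (h02 : P' m₂ = 0) (h21 : HasDerivAt P' c₁ m₁) (h22 : HasDerivAt P' c₂ m₂) (hc₁ : c₁ < 0)
    (hc₂ : c₂ < 0) (hlt : m₁ < m₂) (huniq : ∀ y, y ≠ m₁ → y ≠ m₂ → P y < 0)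
    {f : ℝ → ℝ} (hf : Continuous f) {C : ℝ} (hC : ∀ y, |f y| ≤ C) :
    Tendsto (fun n : ℕ => √n * ∫ y, f y * (Real.exp (n * P y) * R n y)) atTop
      (𝓝 (f m₁ * Rlim m₁ * √(2 * Real.pi / -c₁) + f m₂ * Rlim m₂ * √(2 * Real.pi / -c₂))) := by
  obtain ⟨ε₁, hε₁, hb₁⟩ := hL.tendsto_setIntegral_ball (Eventually.of_forall hP) hm₁ h01 h21 hc₁
  obtain ⟨ε₂, hε₂, hb₂⟩ := hL.tendsto_setIntegral_ball (Eventually.of_forall hP) hm₂ h02 h22 hc₂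
  set ε := min (min ε₁ ε₂) ((m₂ - m₁) / 2)
  have hε : 0 < ε := lt_min (lt_min hε₁ hε₂) (by linarith)
  have h1 := hb₁ ε hε ((min_le_left _ _).trans (min_le_left _ _)) f hf C hC
  have h2 := hb₂ ε hε ((min_le_left _ _).trans (min_le_right _ _)) f hf C hC
  set E := (Metric.ball m₁ ε ∪ Metric.ball m₂ ε)ᶜ
  have hE : IsClosed E := (Metric.isOpen_ball.union Metric.isOpen_ball).isClosed_compl
  have hPE : ∀ y ∈ E, P y < 0 := fun y hy => huniq y
    (fun h => hy (Or.inl (h ▸ Metric.mem_ball_self hε)))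
    (fun h => hy (Or.inr (h ▸ Metric.mem_ball_self hε)))
  have h3 := hL.tendsto_setIntegral_zero hE hPE hC
  have hsum := (h1.add h2).add h3
  rw [add_zero] at hsum
  refine hsum.congr' ?_
  filter_upwards [eventually_ne_atTop 0] with n hn
  have hi := hL.integrable_integrand hf.measurable hC hn
  have hdisj : Disjoint (Metric.ball m₁ ε) (Metric.ball m₂ ε) := by
    refine Metric.ball_disjoint_ball ?_
    rw [Real.dist_eq, abs_sub_comm, abs_of_pos (sub_pos.2 hlt)]
    have : ε ≤ (m₂ - m₁) / 2 := min_le_right _ _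
    linarith
  rw [← mul_add, ← mul_add, ← setIntegral_union hdisj measurableSet_ball hi.integrableOn
    hi.integrableOn, integral_add_compl (measurableSet_ball.union measurableSet_ball) hi]

end LaplaceData

/-! ### Gaussian smoothing of the Gibbs measure. -/

lemma integrable_exp_neg_mul_sq_add {J : ℝ} (hJ : 0 < J) (a b : ℝ) :
    Integrable fun y : ℝ => Real.exp (-J * y ^ 2 + a * y + b) := by
  have := (integrable_cexp_quadratic (b := J) (by simpa) a b).norm
  refine this.congr (Eventually.of_forall fun y => ?_)
  simp only [Complex.norm_exp]
  congr 1
  norm_cast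

/-- The partition function of the monomer-dimer model with monomer field `x`. -/
noncomputable def monomerDimerPartition (N : ℕ) (x : ℝ) : ℝ :=
  ∑ D : CompleteDimerConfig N, (N : ℝ) ^ (-(D.dimers.card : ℤ)) * Real.exp x ^ monomerCount D

lemma monomerDimerPartition_eq (x : ℝ) {N : ℕ} (hN : N ≠ 0) :
    monomerDimerPartition N x = Real.exp (N * pZero x) * saddleFactor N (saddle x) := by
  rw [monomerDimerPartition, sum_dimerConfig_eq_gaussMoment, gaussMoment_eq_saddleFactor x hN]

/-- Used to read off positivity and measurability from a finite sum: for odd `N` the integrand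
defining `saddleFactor` changes sign. -/
lemma saddleFactor_saddle_eq (x : ℝ) {N : ℕ} (hN : N ≠ 0) :
    saddleFactor N (saddle x) = Real.exp (-(N * pZero x)) * monomerDimerPartition N x := by
  rw [monomerDimerPartition_eq x hN, ← mul_assoc, ← Real.exp_add, neg_add_cancel, Real.exp_zero,
    one_mul]

lemma monomerDimerPartition_nonneg (N : ℕ) (x : ℝ) : 0 ≤ monomerDimerPartition N x :=
  Finset.sum_nonneg fun _ _ => by positivity

lemma continuous_monomerDimerPartition (N : ℕ) : Continuous (monomerDimerPartition N) := by
  unfold monomerDimerPartition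
  fun_prop

lemma continuous_pZero : Continuous pZero :=
  continuous_iff_continuousAt.2 fun x => (hasDerivAt_pZero x).continuousAt

/-- The dominating factor blows up as `x → -∞`, where `s → 1`, but only exponentially: `(1 - s²)(1 +
e^(-x)) = e^x s + s ≥ e^x s + s² = 1`. -/
lemma inv_sqrt_one_sub_saddle_sq_le (x : ℝ) :
    (√(1 - saddle x ^ 2))⁻¹ ≤ 1 + Real.exp (-x) := by
  have he := Real.exp_pos x
  have hs := saddle_pos x
  have hg := gFun_pos x
  rw [gFun_eq_one_sub_saddle_sq] at hg
  have h1 : (1 - saddle x ^ 2)⁻¹ ≤ 1 + Real.exp (-x) := by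
    rw [inv_le_iff_one_le_mul₀ hg, show 1 - saddle x ^ 2 = Real.exp x * saddle x by
      linarith [saddle_sq_add x], Real.exp_neg]
    have : (1 + (Real.exp x)⁻¹) * (Real.exp x * saddle x) = Real.exp x * saddle x + saddle x := by
      field_simp
    rw [this]
    nlinarith [saddle_sq_add x, saddle_lt_one x]
  have h2 : 1 - saddle x ^ 2 ≤ √(1 - saddle x ^ 2) :=
    Real.le_sqrt_self_iff.2 (by nlinarith)
  exact (inv_anti₀ hg h2).trans h1

/-- The smoothed Gibbs weights are a Laplace integrand with exponent `pTilde`. -/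
lemma laplaceData_pTilde {h J : ℝ} (hJ : 0 < J) {m : ℝ} (hm : m ∈ globalMaxPoints h J) :
    LaplaceData (fun y => pTilde h J y - pTilde h J m)
      (fun y => 1 + Real.exp (-((2 * y - 1) * J + h)))
      (fun y => (√(1 + saddle ((2 * y - 1) * J + h) ^ 2))⁻¹)
      (fun n y => saddleFactor n (saddle ((2 * y - 1) * J + h))) where
  continuous_exponent := (continuous_pTilde h J).sub continuous_const
  nonpos y := sub_nonpos.2 (hm y)
  tendsto_exponent := tendsto_atBot_add_const_right _ _ (tendsto_pTilde_cocompact hJ)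
  continuous_bound := by fun_prop
  integrable := by
    have hcont := continuous_pTilde h J
    -- The three Gaussians come from `(1 + e^x)(1 + e^(-x)) = 2 + e^x + e^(-x)` with `x` affine in
    -- `y`.
    have h1 := ((integrable_exp_neg_mul_sq_add hJ 0 (-pTilde h J m)).const_mul 2).add
      ((integrable_exp_neg_mul_sq_add hJ (2 * J) (-J + h - pTilde h J m)).add
        (integrable_exp_neg_mul_sq_add hJ (-(2 * J)) (J - h - pTilde h J m)))
    refine h1.mono' (Continuous.aestronglyMeasurable (by fun_prop))
      (Eventually.of_forall fun y => ?_)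
    rw [Real.norm_of_nonneg (by positivity)]
    set x := (2 * y - 1) * J + h with hx
    have h2 : Real.exp (pTilde h J y - pTilde h J m) ≤
        Real.exp (-J * y ^ 2 - pTilde h J m) * (1 + Real.exp x) := by
      have h3 := pTilde_le_log h J y
      rw [← Real.exp_log (show 0 < 1 + Real.exp x by positivity), ← Real.exp_add,
        Real.exp_le_exp]
      linarith
    calc _ ≤ Real.exp (-J * y ^ 2 - pTilde h J m) * (1 + Real.exp x) * (1 + Real.exp (-x)) := by
          gcongr
      _ = 2 * Real.exp (-J * y ^ 2 - pTilde h J m) +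
          (Real.exp (-J * y ^ 2 - pTilde h J m) * Real.exp x +
            Real.exp (-J * y ^ 2 - pTilde h J m) * Real.exp (-x)) := by
          have : Real.exp x * Real.exp (-x) = 1 := by
            rw [← Real.exp_add, add_neg_cancel, Real.exp_zero]
          linear_combination Real.exp (-J * y ^ 2 - pTilde h J m) * this
      _ = _ := by
          rw [← Real.exp_add, ← Real.exp_add, hx]
          simp only [Pi.add_apply]
          ring_nf
  measurable n hn := by
    simp_rw [saddleFactor_saddle_eq _ hn]
    have h1 := continuous_pZero
    have h2 := continuous_monomerDimerPartition n
    exact Continuous.measurable (by fun_prop)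
  nonneg n hn y := by
    rw [saddleFactor_saddle_eq _ hn]
    exact mul_nonneg (Real.exp_pos _).le (monomerDimerPartition_nonneg _ _)
  le_bound n hn y := by
    have hs := saddle_pos ((2 * y - 1) * J + h)
    have hs1 := saddle_lt_one ((2 * y - 1) * J + h)
    exact (le_abs_self _).trans ((saddleFactor_le hn (by nlinarith)).trans
      (inv_sqrt_one_sub_saddle_sq_le _))
  tendsto y z hy := by
    have hs := saddle_pos ((2 * z - 1) * J + h)
    have hs1 := saddle_lt_one ((2 * z - 1) * J + h)
    have hc : Continuous fun y : ℝ => saddle ((2 * y - 1) * J + h) :=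
      continuous_saddle.comp (by fun_prop)
    exact tendsto_saddleFactor ((hc.tendsto z).comp hy) (by nlinarith)

/-- Hubbard-Stratonovich: the Laplace integrand is the Gaussian smoothing of the Gibbs weights. -/
lemma exp_pTilde_mul_saddleFactor (h J y : ℝ) {N : ℕ} (hN : N ≠ 0) :
    Real.exp (N * pTilde h J y) * saddleFactor N (saddle ((2 * y - 1) * J + h)) =
      ∑ D : CompleteDimerConfig N,
        imdWeight h J D * Real.exp (-(N * J) * (y - monomerDensity D) ^ 2) := by
  have hN' : (N : ℝ) ≠ 0 := by exact_mod_cast hN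
  have h1 : Real.exp (N * pTilde h J y) = Real.exp (-(N * J) * y ^ 2) *
      Real.exp (N * pZero ((2 * y - 1) * J + h)) := by
    rw [← Real.exp_add, pTilde]
    congr 1
    ring
  rw [h1, mul_assoc, ← monomerDimerPartition_eq _ hN, monomerDimerPartition, Finset.mul_sum]
  refine Finset.sum_congr rfl fun D _ => ?_
  have h2 : (monomerCount D : ℝ) = N * monomerDensity D := by
    rw [monomerDensity]
    field_simp
  -- Completing the square: `(h - J)m + Jm² - J(y - m)² = -Jy² + m((2y - 1)J + h)`, so the
  -- interaction becomes linear in the monomer count.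
  rw [imdWeight, imdHamiltonian, mul_left_comm, mul_assoc, ← Real.exp_nat_mul, ← Real.exp_add,
    ← Real.exp_add, h2]
  congr 2
  ring

lemma integral_exp_neg_mul_sub_sq (b m : ℝ) :
    ∫ y, Real.exp (-b * (y - m) ^ 2) = √(Real.pi / b) := by
  rw [integral_sub_right_eq_self (fun y => Real.exp (-b * y ^ 2)) m, integral_gaussian]

lemma integrable_exp_neg_mul_sub_sq {b : ℝ} (hb : 0 < b) (m : ℝ) :
    Integrable fun y => Real.exp (-b * (y - m) ^ 2) :=
  (integrable_exp_neg_mul_sq hb).comp_sub_right m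

lemma integrable_abs_mul_exp_neg_mul_sq {b : ℝ} (hb : 0 < b) :
    Integrable fun y : ℝ => |y| * Real.exp (-b * y ^ 2) := by
  refine (integrable_mul_exp_neg_mul_sq hb).norm.congr (Eventually.of_forall fun y => ?_)
  simp

lemma integral_abs_mul_exp_scale {J : ℝ} {N : ℕ} (hN : N ≠ 0) :
    ∫ y : ℝ, |y| * Real.exp (-(N * J) * y ^ 2) =
      (N : ℝ)⁻¹ * ∫ u : ℝ, |u| * Real.exp (-J * u ^ 2) := by
  have hN1 : 0 < √(N : ℝ) := Real.sqrt_pos.2 (by positivity)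
  have h1 := Measure.integral_comp_mul_left (fun u : ℝ => |u| * Real.exp (-J * u ^ 2)) (√N)
  have hsq : √(N : ℝ) ^ 2 = N := Real.sq_sqrt N.cast_nonneg
  have h2 : ∀ y : ℝ, |√N * y| * Real.exp (-J * (√N * y) ^ 2) =
      √N * (|y| * Real.exp (-(N * J) * y ^ 2)) := by
    intro y
    rw [abs_mul, abs_of_pos hN1, mul_pow, hsq]
    ring_nf
  simp_rw [h2] at h1
  rw [integral_const_mul, abs_of_pos (inv_pos.2 hN1), smul_eq_mul] at h1
  rw [← hsq]
  field_simp
  rw [hsq]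
  field_simp at h1
  rw [hsq] at h1
  linarith

lemma abs_integral_lipschitz_sub_le {b : ℝ} (hb : 0 < b) {f : ℝ → ℝ} {L : NNReal}
    (hf : LipschitzWith L f) (m : ℝ) :
    |(∫ y, f y * Real.exp (-b * (y - m) ^ 2)) - f m * √(Real.pi / b)| ≤
      L * ∫ y : ℝ, |y| * Real.exp (-b * y ^ 2) := by
  have i1 := (integrable_exp_neg_mul_sub_sq hb m).const_mul (f m)
  have i2 := (integrable_abs_mul_exp_neg_mul_sq hb).comp_sub_right m
  have hle : ∀ y, ‖(f y - f m) * Real.exp (-b * (y - m) ^ 2)‖ ≤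
      L * (|y - m| * Real.exp (-b * (y - m) ^ 2)) := by
    intro y
    rw [norm_mul, Real.norm_of_nonneg (Real.exp_pos _).le, ← mul_assoc]
    gcongr
    simpa [Real.dist_eq] using hf.dist_le_mul y m
  have hc := hf.continuous
  have i3 : Integrable fun y => (f y - f m) * Real.exp (-b * (y - m) ^ 2) :=
    (i2.const_mul (L : ℝ)).mono' (Continuous.aestronglyMeasurable (by fun_prop))
      (Eventually.of_forall hle)
  have h1 : ∫ y, f y * Real.exp (-b * (y - m) ^ 2) =
      (∫ y, (f y - f m) * Real.exp (-b * (y - m) ^ 2)) + f m * √(Real.pi / b) := by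
    rw [← integral_exp_neg_mul_sub_sq b m, ← integral_const_mul, ← integral_add i3 i1]
    congr 1
    ext y
    ring
  rw [h1, add_sub_cancel_right, ← Real.norm_eq_abs, ← integral_sub_right_eq_self
    (fun y : ℝ => |y| * Real.exp (-b * y ^ 2)) m, ← integral_const_mul]
  exact norm_integral_le_of_norm_le (i2.const_mul (L : ℝ)) (Eventually.of_forall hle)

lemma integral_imdGibbs (h J : ℝ) (N : ℕ) (F : CompleteDimerConfig N → ℝ) :
    ∫ D, F D ∂(imdGibbs h J N) =
      (∑ D : CompleteDimerConfig N, imdWeight h J D * F D) / imdPartition h J N := by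
  have hF : Measurable F := measurable_from_top
  rw [imdGibbs, integral_finsetSum_measure, Finset.sum_div]
  · refine Finset.sum_congr rfl fun D _ => ?_
    rw [integral_smul_measure, integral_dirac' _ _ hF.stronglyMeasurable, ENNReal.toReal_ofReal
      (div_pos (imdWeight_pos h J D) (imdPartition_pos h J N)).le, smul_eq_mul]
    ring
  · intro D _
    exact (integrable_dirac' hF.stronglyMeasurable (by simp)).smul_measure ENNReal.ofReal_ne_top

section Smoothing

variable {h J : ℝ}

lemma integral_smoothed (hJ : 0 < J) {f : ℝ → ℝ} (hf : Continuous f) {C : ℝ}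
    (hC : ∀ y, |f y| ≤ C) {N : ℕ} (hN : N ≠ 0) :
    ∫ y, f y * (Real.exp (N * pTilde h J y) * saddleFactor N (saddle ((2 * y - 1) * J + h))) =
      ∑ D : CompleteDimerConfig N, imdWeight h J D *
        ∫ y, f y * Real.exp (-(N * J) * (y - monomerDensity D) ^ 2) := by
  have hb : 0 < (N : ℝ) * J := by positivity
  simp_rw [exp_pTilde_mul_saddleFactor h J _ hN, Finset.mul_sum, mul_left_comm (f _)]
  rw [integral_finsetSum]
  · exact Finset.sum_congr rfl fun D _ => integral_const_mul _ _
  · intro D _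
    exact ((integrable_exp_neg_mul_sub_sq hb _).bdd_mul hf.aestronglyMeasurable
      (Eventually.of_forall hC)).const_mul _

/-- The smoothing does not change limits in distribution. -/
lemma tendsto_smoothed_sub_gibbs (hJ : 0 < J) {f : ℝ → ℝ} {L : NNReal} (hf : LipschitzWith L f)
    {C : ℝ} (hC : ∀ y, |f y| ≤ C) (M : ℝ) :
    Tendsto (fun N : ℕ =>
      (∫ y, f y * (Real.exp (N * (pTilde h J y - M)) *
          saddleFactor N (saddle ((2 * y - 1) * J + h)))) /
        (∫ y, Real.exp (N * (pTilde h J y - M)) *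
          saddleFactor N (saddle ((2 * y - 1) * J + h))) -
      ∫ D, f (monomerDensity D) ∂(imdGibbs h J N)) atTop (𝓝 0) := by
  set K := ∫ u : ℝ, |u| * Real.exp (-J * u ^ 2)
  have hlim : Tendsto (fun N : ℕ => (√(N : ℝ))⁻¹ * (L * K / √(Real.pi / J))) atTop (𝓝 0) := by
    have : Tendsto (fun n : ℕ => (√(n : ℝ))⁻¹) atTop (𝓝 0) :=
      (Real.tendsto_sqrt_atTop.comp tendsto_natCast_atTop_atTop).inv_tendsto_atTop
    simpa using this.mul_const (L * K / √(Real.pi / J))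
  refine squeeze_zero_norm' ?_ hlim
  filter_upwards [eventually_ne_atTop 0] with N hN
  have hb : 0 < (N : ℝ) * J := by positivity
  have hshift : ∀ y : ℝ, Real.exp (N * (pTilde h J y - M)) =
      Real.exp (-(N * M)) * Real.exp (N * pTilde h J y) := by
    intro y
    rw [← Real.exp_add]
    ring_nf
  have hA1 := integral_smoothed (h := h) hJ (f := fun _ => 1) continuous_const (C := 1) (by simp) hN
  simp only [one_mul, integral_exp_neg_mul_sub_sq] at hA1
  rw [← Finset.sum_mul, ← imdPartition] at hA1
  have hAf := integral_smoothed (h := h) hJ hf.continuous hC hN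
  simp_rw [hshift, mul_assoc, mul_left_comm (f _) (Real.exp (-(N * M)))]
  rw [integral_const_mul, integral_const_mul, mul_div_mul_left _ _ (Real.exp_pos _).ne', hA1, hAf,
    integral_imdGibbs]
  set c := √(Real.pi / (N * J)) with hc
  have hc0 : 0 < c := Real.sqrt_pos.2 (by positivity)
  have hZ := imdPartition_pos h J N
  rw [show (∑ D : CompleteDimerConfig N, imdWeight h J D * f (monomerDensity D)) /
      imdPartition h J N = (∑ D : CompleteDimerConfig N, imdWeight h J D *
        (f (monomerDensity D) * c)) / (imdPartition h J N * c) by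
    simp_rw [← mul_assoc]
    rw [← Finset.sum_mul, mul_div_mul_right _ _ hc0.ne'], ← sub_div, ← Finset.sum_sub_distrib,
    norm_div, Real.norm_of_nonneg (mul_pos hZ hc0).le, div_le_iff₀ (mul_pos hZ hc0)]
  have hcs : c = (√(N : ℝ))⁻¹ * √(Real.pi / J) := by
    rw [hc, ← Real.sqrt_inv, ← Real.sqrt_mul (by positivity)]
    congr 1
    field_simp
  have hpi : 0 < √(Real.pi / J) := Real.sqrt_pos.2 (by positivity)
  -- The first absolute moment of the unnormalized kernel is of order `N^(-1)` and its mass `c` of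
  -- order `N^(-1/2)`, so the quotient is `O(N^(-1/2))`.
  calc _ ≤ ∑ D : CompleteDimerConfig N, imdWeight h J D * (L * ((N : ℝ)⁻¹ * K)) := by
        refine (norm_sum_le _ _).trans (Finset.sum_le_sum fun D _ => ?_)
        rw [← mul_sub, norm_mul, Real.norm_of_nonneg (imdWeight_pos h J D).le,
          ← integral_abs_mul_exp_scale hN]
        exact mul_le_mul_of_nonneg_left (abs_integral_lipschitz_sub_le hb hf _)
          (imdWeight_pos h J D).le
    _ = imdPartition h J N * (L * ((N : ℝ)⁻¹ * K)) := by rw [← Finset.sum_mul, imdPartition]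
    _ = _ := by
        have hN1 : (√(N : ℝ))⁻¹ * (√(N : ℝ))⁻¹ = (N : ℝ)⁻¹ := by
          rw [← mul_inv, Real.mul_self_sqrt N.cast_nonneg]
        rw [hcs, ← hN1]
        field_simp

/-! ### Limits of bounded Lipschitz averages. -/

lemma tendstoInDistribution_of_lipschitz {ν : Measure ℝ} [IsProbabilityMeasure ν]
    (hlim : ∀ f : ℝ → ℝ, (∃ L, LipschitzWith L f) → ∀ C, (∀ y, |f y| ≤ C) →
      Tendsto (fun N : ℕ => ∫ D, f (monomerDensity D) ∂(imdGibbs h J N)) atTop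
        (𝓝 (∫ y, f y ∂ν))) :
    TendstoInDistribution (fun N : ℕ => (monomerDensity : CompleteDimerConfig N → ℝ)) atTop
      (id : ℝ → ℝ) (fun N : ℕ => imdGibbs h J N) ν where
  forall_aemeasurable N := measurable_from_top.aemeasurable
  aemeasurable_limit := aemeasurable_id
  tendsto := by
    refine tendsto_iff_forall_lipschitz_integral_tendsto.2 ?_
    rintro f ⟨C, hC⟩ ⟨L, hL⟩
    -- Boundedness of the test function is given as a bound `C` on its oscillation.
    have hbdd : ∀ y, |f y| ≤ |f 0| + C := by
      intro y
      have h1 := hC y 0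
      rw [Real.dist_eq] at h1
      linarith [abs_sub_abs_le_abs_sub (f y) (f 0)]
    have hlim' := hlim f ⟨L, hL⟩ _ hbdd
    have hmap : ∫ y, f y ∂ν = ∫ y, f y ∂(ν.map id) := by rw [Measure.map_id]
    rw [hmap] at hlim'
    refine hlim'.congr fun N => ?_
    exact (integral_map (μ := imdGibbs h J N) measurable_from_top.aemeasurable
      hL.continuous.aestronglyMeasurable).symm

lemma tendsto_gibbs_of_unique (hJ : 0 < J) {m : ℝ} (hm : globalMaxPoints h J = {m}) {f : ℝ → ℝ}
    {L : NNReal} (hf : LipschitzWith L f) {C : ℝ} (hC : ∀ y, |f y| ≤ C) :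
    Tendsto (fun N : ℕ => ∫ D, f (monomerDensity D) ∂(imdGibbs h J N)) atTop (𝓝 (f m)) := by
  have hmem : m ∈ globalMaxPoints h J := hm ▸ mem_singleton m
  -- The second derivative at `m` may vanish here; the concentration argument does not use its sign.
  have h1 := (laplaceData_pTilde hJ hmem).tendsto_ratio_of_unique
    (Eventually.of_forall fun y => (hasDerivAt_pTilde h J y).sub_const (pTilde h J m))
    (sub_self _) (by rw [gFun_eq_of_mem_globalMaxPoints hJ hmem]; ring)
    (hasDerivAt_pTilde_deriv h J m) (by positivity) (fun y hy => ?_) hf.continuous hC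
  · simpa using h1.sub (tendsto_smoothed_sub_gibbs (h := h) hJ hf hC (pTilde h J m))
  · refine sub_neg.2 (lt_of_not_ge fun hle => hy ?_)
    have : y ∈ globalMaxPoints h J := fun x => (hmem x).trans hle
    rwa [hm] at this

/-- At a maximum `1 + s² = 2 - g = 2 - m`: the fluctuations of the Gaussian representation supply
the factor `2 - m`, and those of Laplace's method supply `-λ`. -/
lemma prefactor_eq_phaseWeight (hJ : 0 < J) {m : ℝ} (hm : m ∈ globalMaxPoints h J)
    (hc : curvature h J m < 0) :
    (√(1 + saddle ((2 * m - 1) * J + h) ^ 2))⁻¹ * √(2 * Real.pi / -curvature h J m) =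
      √(2 * Real.pi) * phaseWeight h J m := by
  have h1 : 1 + saddle ((2 * m - 1) * J + h) ^ 2 = 2 - m := by
    linarith [gFun_eq_one_sub_saddle_sq ((2 * m - 1) * J + h),
      gFun_eq_of_mem_globalMaxPoints hJ hm]
  have h2 : 0 < 2 - m := by linarith [(mem_Ioo_of_mem_globalMaxPoints hJ hm).2]
  have h3 : 0 < -curvature h J m := neg_pos.2 hc
  rw [h1, phaseWeight, Real.rpow_neg (by positivity), ← Real.sqrt_eq_rpow, ← Real.sqrt_inv,
    ← Real.sqrt_inv, ← Real.sqrt_mul (by positivity), ← Real.sqrt_mul (by positivity)]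
  congr 1
  field_simp

lemma phaseWeight_pos (hJ : 0 < J) {m : ℝ} (hm : m ∈ globalMaxPoints h J)
    (hc : curvature h J m < 0) : 0 < phaseWeight h J m :=
  Real.rpow_pos_of_pos (mul_pos (neg_pos.2 hc)
    (by linarith [(mem_Ioo_of_mem_globalMaxPoints hJ hm).2])) _

lemma tendsto_gibbs_of_pair (hJ : 0 < J) {m₁ m₂ : ℝ} (hm : globalMaxPoints h J = {m₁, m₂})
    (hlt : m₁ < m₂) (hc₁ : curvature h J m₁ < 0) (hc₂ : curvature h J m₂ < 0) {f : ℝ → ℝ}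
    {L : NNReal} (hf : LipschitzWith L f) {C : ℝ} (hC : ∀ y, |f y| ≤ C) :
    Tendsto (fun N : ℕ => ∫ D, f (monomerDensity D) ∂(imdGibbs h J N)) atTop
      (𝓝 ((phaseWeight h J m₁ * f m₁ + phaseWeight h J m₂ * f m₂) /
        (phaseWeight h J m₁ + phaseWeight h J m₂))) := by
  have h1 : m₁ ∈ globalMaxPoints h J := by simp [hm]
  have h2 : m₂ ∈ globalMaxPoints h J := by simp [hm]
  have hb1 := phaseWeight_pos hJ h1 hc₁
  have hb2 := phaseWeight_pos hJ h2 hc₂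
  have hpi : 0 < √(2 * Real.pi) := by positivity
  have hint : ∀ f : ℝ → ℝ, Continuous f → ∀ C, (∀ y, |f y| ≤ C) → Tendsto (fun N : ℕ => √N *
      ∫ y, f y * (Real.exp (N * (pTilde h J y - pTilde h J m₁)) *
        saddleFactor N (saddle ((2 * y - 1) * J + h)))) atTop
      (𝓝 (√(2 * Real.pi) * (phaseWeight h J m₁ * f m₁ + phaseWeight h J m₂ * f m₂))) := by
    intro f hf C hC
    have h3 := (laplaceData_pTilde hJ h1).tendsto_integral_of_pair
      (fun y => (hasDerivAt_pTilde h J y).sub_const (pTilde h J m₁)) (sub_self _)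
      (sub_eq_zero.2 (le_antisymm (h1 m₂) (h2 m₁)))
      (by rw [gFun_eq_of_mem_globalMaxPoints hJ h1]; ring)
      (by rw [gFun_eq_of_mem_globalMaxPoints hJ h2]; ring)
      ((hasDerivAt_pTilde_deriv h J m₁).congr_deriv (curvature_eq h J m₁).symm)
      ((hasDerivAt_pTilde_deriv h J m₂).congr_deriv (curvature_eq h J m₂).symm) hc₁ hc₂ hlt
      (fun y hy1 hy2 => ?_) hf hC
    · rw [mul_assoc, mul_assoc (f m₂), prefactor_eq_phaseWeight hJ h1 hc₁,
        prefactor_eq_phaseWeight hJ h2 hc₂] at h3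
      convert! h3 using 2
      ring
    · refine sub_neg.2 (lt_of_not_ge fun hle => ?_)
      have : y ∈ globalMaxPoints h J := fun x => (h1 x).trans hle
      rw [hm] at this
      rcases this with h4 | h4
      · exact hy1 h4
      · exact hy2 h4
  have hone := hint (fun _ => 1) continuous_const 1 (by simp)
  simp only [one_mul, mul_one] at hone
  have hratio := (hint f hf.continuous C hC).div hone (by positivity)
  rw [mul_div_mul_left _ _ hpi.ne'] at hratio
  have hsub := tendsto_smoothed_sub_gibbs (h := h) hJ hf hC (pTilde h J m₁)
  have := hratio.sub hsub
  rw [sub_zero] at this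
  refine this.congr' ?_
  filter_upwards [eventually_ne_atTop 0] with N hN
  have hN1 : √(N : ℝ) ≠ 0 := (Real.sqrt_pos.2 (by positivity)).ne'
  simp only [Pi.div_apply]
  rw [mul_div_mul_left _ _ hN1, sub_sub_cancel]

end Smoothing

/-! ### The theorem. -/

theorem theorem2 (h J : ℝ) (hJ : 0 < J) :
    ((h, J) ∉ coexistenceCurve →
      ∃ mstar : ℝ, globalMaxPoints h J = {mstar} ∧
        TendstoInDistribution (fun N : ℕ => (monomerDensity : CompleteDimerConfig N → ℝ)) atTop
          (id : ℝ → ℝ) (fun N : ℕ => imdGibbs h J N) (Measure.dirac mstar)) ∧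
    ((h, J) ∈ coexistenceCurve →
      ∃ m₁ m₂ : ℝ, 0 < m₁ ∧ m₁ < m₂ ∧ m₂ < 1 ∧ globalMaxPoints h J = {m₁, m₂} ∧
        curvature h J m₁ < 0 ∧ curvature h J m₂ < 0 ∧
        ∃ ν : ProbabilityMeasure ℝ,
          (ν : Measure ℝ) =
            ENNReal.ofReal (phaseWeight h J m₁ / (phaseWeight h J m₁ + phaseWeight h J m₂)) •
                Measure.dirac m₁ +
              ENNReal.ofReal (phaseWeight h J m₂ / (phaseWeight h J m₁ + phaseWeight h J m₂)) •
                Measure.dirac m₂ ∧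
          TendstoInDistribution (fun N : ℕ => (monomerDensity : CompleteDimerConfig N → ℝ)) atTop
            (id : ℝ → ℝ) (fun N : ℕ => imdGibbs h J N) (ν : Measure ℝ)) := by
  constructor
  · intro hγ
    obtain ⟨m, hm⟩ := globalMaxPoints_nonempty h hJ
    have hsub : (globalMaxPoints h J).Subsingleton :=
      not_nontrivial_iff.1 fun hn => hγ ⟨hJ, hn⟩
    have heq := hsub.eq_singleton_of_mem hm
    refine ⟨m, heq, tendstoInDistribution_of_lipschitz ?_⟩
    rintro f ⟨L, hL⟩ C hC
    rw [integral_dirac]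
    exact tendsto_gibbs_of_unique hJ heq hL hC
  · rintro ⟨-, hn⟩
    obtain ⟨m₁, h1, m₂, h2, hlt⟩ := hn.exists_lt
    have heq := globalMaxPoints_eq_pair hJ h1 h2 hlt
    obtain ⟨hQ1, hQ2⟩ := defectQuadratic_pos_of_lt hJ h1 h2 hlt
    have hc1 := curvature_neg_of_defectQuadratic_pos hJ h1 hQ1
    have hc2 := curvature_neg_of_defectQuadratic_pos hJ h2 hQ2
    have hb1 := phaseWeight_pos hJ h1 hc1
    have hb2 := phaseWeight_pos hJ h2 hc2
    refine ⟨m₁, m₂, (mem_Ioo_of_mem_globalMaxPoints hJ h1).1, hlt,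
      (mem_Ioo_of_mem_globalMaxPoints hJ h2).2, heq, hc1, hc2, ?_⟩
    set b₁ := phaseWeight h J m₁
    set b₂ := phaseWeight h J m₂
    have hprob : IsProbabilityMeasure (ENNReal.ofReal (b₁ / (b₁ + b₂)) • Measure.dirac m₁ +
        ENNReal.ofReal (b₂ / (b₁ + b₂)) • Measure.dirac m₂) := by
      refine ⟨?_⟩
      simp only [Measure.add_apply, Measure.smul_apply, measure_univ, smul_eq_mul, mul_one]
      rw [← ENNReal.ofReal_add (by positivity) (by positivity), ← add_div,
        div_self (by positivity), ENNReal.ofReal_one]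
    let ν : ProbabilityMeasure ℝ := ⟨_, hprob⟩
    refine ⟨ν, rfl, tendstoInDistribution_of_lipschitz (ν := (ν : Measure ℝ)) ?_⟩
    rintro f ⟨L, hL⟩ C hC
    have hi : ∀ m : ℝ, Integrable f (Measure.dirac m) := fun m =>
      integrable_dirac' hL.continuous.stronglyMeasurable (by simp)
    have hν : ∫ y, f y ∂(ν : Measure ℝ) = (b₁ * f m₁ + b₂ * f m₂) / (b₁ + b₂) := by
      change ∫ y, f y ∂(ENNReal.ofReal (b₁ / (b₁ + b₂)) • Measure.dirac m₁ +
        ENNReal.ofReal (b₂ / (b₁ + b₂)) • Measure.dirac m₂) = _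
      rw [integral_add_measure ((hi m₁).smul_measure ENNReal.ofReal_ne_top)
        ((hi m₂).smul_measure ENNReal.ofReal_ne_top), integral_smul_measure,
        integral_smul_measure, integral_dirac, integral_dirac,
        ENNReal.toReal_ofReal (by positivity), ENNReal.toReal_ofReal (by positivity), smul_eq_mul,
        smul_eq_mul, div_mul_eq_mul_div, div_mul_eq_mul_div, ← add_div]
    rw [hν]
    exact tendsto_gibbs_of_pair hJ heq hlt hc1 hc2 hL hC
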